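/- Let $\omega>0$ and let $A:\mathbb{R}\to\mathcal{L}(\mathbb{R}^n)$ (real $n\times n$ matrices with the operator norm) have bounded variation on every compact interval. Write $\Delta^-A(t)=A(t)-A(t^-)$ and $\Delta^+A(t)=A(t^+)-A(t)$. Assume that $I-\Delta^-A(t)$ and $I+\Delta^+A(t)$ are invertible for every $t\in\mathbb{R}$, and that there is a constant matrix $C$ with $A(t+\omega)-A(t)=C$ for all $t\in\mathbb{R}$. Then the homogeneous generalized linear differential equation $$\frac{dx}{d\tau}=D[A(t)x]$$ has a unique transition matrix, that is, there is exactly one function $U:\mathbb{R}\times\mathbb{R}\to\mathcal{L}(\mathbb{R}^n)$ such that $$U(t,s)=I+\int_s^t \mathrm{d}[A(r)]\,U(r,s)\qquad\text{for all } t,s\in\mathbb{R},$$ where the integral is the Kurzweil--Stieltjes integral (required to exist, column by column): for $a\le b$, $\int_a^b \mathrm{d}[A(s)]f(s)=X$ means that for every $\varepsilon>0$ there is a function $\delta:[a,b]\to(0,\infty)$ such that $\bigl\|\sum_{j}[A(\alpha_j)-A(\alpha_{j-1})]f(\tau_j)-X\bigr\|<\varepsilon$ for every partition $a=\alpha_0<\dots<\alpha_m=b$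 with tags $\tau_j\in[\alpha_{j-1},\alpha_j]\subset(\tau_j-\delta(\tau_j),\tau_j+\delta(\tau_j))$; and $\int_b^a=-\int_a^b$. Put $\mathcal{U}(t)=U(t,0)$. The equation admits an exponential dichotomy on $\mathbb{R}$, that is, there exist constants $K>0$, $\alpha>0$ and a matrix $P\in\mathcal{L}(\mathbb{R}^n)$ with $P^2=P$ such that $$\|\mathcal{U}(t)P\,\mathcal{U}^{-1}(s)\|\le Ke^{-\alpha(t-s)}\ \text{ for all } t\ge s,\qquad \|\mathcal{U}(t)(I-P)\,\mathcal{U}^{-1}(s)\|\le Ke^{-\alpha(s-t)}\ \text{ for all } s\ge t,$$ if and only if no complex eigenvalue $\lambda$ of the monodromy matrix $U(\omega,0)$ satisfies $|\lambda|=1$. -/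

import Mathlib

/-- Real Euclidean `n`-space. -/
abbrev RSpace (n : ℕ) : Type := EuclideanSpace ℝ (Fin n)

/-- Linear operators on `ℝⁿ` (real `n × n` matrices), with the operator norm. -/
abbrev ROp (n : ℕ) : Type := RSpace n →L[ℝ] RSpace n

/-- The data `α 0 < α 1 < ⋯ < α m` with tags `τ j ∈ [α j, α (j+1)]`, `j < m`, form a tagged
partition of `[a, b]` which is fine with respect to the gauge `δ`. -/
def IsFineTaggedPartition (δ : ℝ → ℝ) (a b : ℝ) (m : ℕ) (α τ : ℕ → ℝ) : Prop :=
  α 0 = a ∧ α m = b ∧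
    ∀ j < m, α j < α (j + 1) ∧ τ j ∈ Set.Icc (α j) (α (j + 1)) ∧
      Set.Icc (α j) (α (j + 1)) ⊆ Set.Ioo (τ j - δ (τ j)) (τ j + δ (τ j))

/-- For `a ≤ b`: `f` is Kurzweil–Stieltjes integrable with respect to `A` on `[a, b]`, and
`∫ₐᵇ d[A(s)] f(s) = X`. -/
def HasKSIntegralIcc {n : ℕ} (A : ℝ → ROp n) (f : ℝ → RSpace n) (a b : ℝ) (X : RSpace n) : Prop :=
  ∀ ε > 0, ∃ δ : ℝ → ℝ, (∀ t ∈ Set.Icc a b, 0 < δ t) ∧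
    ∀ (m : ℕ) (α τ : ℕ → ℝ), IsFineTaggedPartition δ a b m α τ →
      ‖∑ j ∈ Finset.range m, (A (α (j + 1)) - A (α j)) (f (τ j)) - X‖ < ε

/-- The oriented Kurzweil–Stieltjes integral `∫ₐᵇ d[A(s)] f(s)` exists and equals `X`, with
`∫ₐᵇ = -∫_bᵃ` when `b < a`. -/
def HasKSIntegral {n : ℕ} (A : ℝ → ROp n) (f : ℝ → RSpace n) (a b : ℝ) (X : RSpace n) : Prop :=
  if a ≤ b then HasKSIntegralIcc A f a b X else HasKSIntegralIcc A f b a (-X)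

/-- The jump `Δ⁺Φ(t) = Φ(t⁺) - Φ(t)`. -/
noncomputable def jumpRight {n : ℕ} (Φ : ℝ → ROp n) (t : ℝ) : ROp n :=
  Function.rightLim Φ t - Φ t

/-- The jump `Δ⁻Φ(t) = Φ(t) - Φ(t⁻)`. -/
noncomputable def jumpLeft {n : ℕ} (Φ : ℝ → ROp n) (t : ℝ) : ROp n :=
  Φ t - Function.leftLim Φ t

/-- Condition (H): `I - Δ⁻A(t)` and `I + Δ⁺A(t)` are invertible for every `t`. -/
def ConditionH {n : ℕ} (A : ℝ → ROp n) : Prop :=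
  ∀ t : ℝ, IsUnit (1 - jumpLeft A t) ∧ IsUnit (1 + jumpRight A t)

/-- `U` is a transition matrix of `dx/dτ = D[A(t)x]`:
`U(t,s) = I + ∫ₛᵗ d[A(r)] U(r,s)` for all `t, s`, the integral being taken vector by vector. -/
def IsTransitionMatrix {n : ℕ} (A : ℝ → ROp n) (U : ℝ → ℝ → ROp n) : Prop :=
  ∀ (t s : ℝ) (v : RSpace n), HasKSIntegral A (fun r => U r s v) s t (U t s v - v)

/-- Exponential dichotomy on `ℝ` of the equation with transition matrix `U`, where
`𝒰(t) = U(t,0)`. -/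
def HasExponentialDichotomy {n : ℕ} (U : ℝ → ℝ → ROp n) : Prop :=
  ∃ (K α : ℝ) (P : ROp n), 0 < K ∧ 0 < α ∧ P * P = P ∧
    (∀ t s : ℝ, s ≤ t →
      ‖U t 0 * P * Ring.inverse (U s 0)‖ ≤ K * Real.exp (-α * (t - s))) ∧
    (∀ t s : ℝ, t ≤ s →
      ‖U t 0 * (1 - P) * Ring.inverse (U s 0)‖ ≤ K * Real.exp (-α * (s - t)))

/-- The matrix of `M` in the standard basis, viewed as a complex matrix. -/
noncomputable def complexMatrix {n : ℕ} (M : ROp n) : Matrix (Fin n) (Fin n) ℂ :=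
  (LinearMap.toMatrix (EuclideanSpace.basisFun (Fin n) ℝ).toBasis
    (EuclideanSpace.basisFun (Fin n) ℝ).toBasis (M : RSpace n →ₗ[ℝ] RSpace n)).map
    (algebraMap ℝ ℂ)

/-- `μ ∈ ℂ` is an eigenvalue of the real matrix `M`. -/
def IsComplexEigenvalue {n : ℕ} (M : ROp n) (μ : ℂ) : Prop :=
  Module.End.HasEigenvalue (Matrix.toLin' (complexMatrix M)) μ

/-! Let `V` be the variation function of `A`. The integral equation is equivalent to a pointwise
first-order condition: at every `τ`, `X t * (X τ)⁻¹` agrees with `1 + (A t - A τ)` up to `ε * |V t -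
V τ|` for `t` near `τ`, for each `ε > 0`. This covers jumps as well as continuous motion, since at a
jump it forces the factor `1 + Δ⁺A` or `1 - Δ⁻A`, invertible by (H). Local information of this kind
is made global by Cousin's lemma, `interval_induction`.

Existence: for fixed `ε` an approximate solution is written down explicitly near each point and
glued (`exists_isApproxSol`). For small `ε` all approximate solutions have uniformly bounded
transition operators (`exists_transition_bound`), and variation of constants makes two of them close
(`norm_transition_sub_le`). Hence they converge to an exact solution as `ε` tends to 0. Conversely,
a solution of the integral equation satisfies the first-order condition
(`eventually_of_hasKSIntegral`) and so is transported by the fundamental solution `X`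
(`eq_of_eventually`). This gives uniqueness, and also Floquet's relation `X (t + ω) = X t * X ω`,
because the increments of `A` are `ω`-periodic.

The dichotomy is then a question about the powers of `M = X ω`. If no eigenvalue lies on the unit
circle, the vectors decaying under `M` and those decaying under `M⁻¹` are complementary subspaces.
The projection along this splitting has exponentially decaying powers
(`exists_hyperbolic_projection`), and boundedness of `X` over one period passes the decay to all `t`
and `s`. If `|μ| = 1`, a real vector has a bounded two-sided orbit; the dichotomy estimates at `t =
0`, with `s = ±kω`, force both of its components to vanish. -/

open Set Filter Topology

/-! ### From local estimates to compact intervals. -/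

/-- Cousin's lemma, in predicate form. -/
theorem interval_induction {P : ℝ → ℝ → Prop} {a b : ℝ} (hab : a ≤ b)
    (htrans : ∀ x y z, a ≤ x → x ≤ y → y ≤ z → z ≤ b → P x y → P y z → P x z)
    (hloc : ∀ τ ∈ Icc a b, ∀ᶠ t in 𝓝[Icc a b] τ, (t ≤ τ → P t τ) ∧ (τ ≤ t → P τ t)) :
    P a b := by
  have hrefl : ∀ τ ∈ Icc a b, P τ τ := fun τ hτ =>
    ((hloc τ hτ).self_of_nhdsWithin hτ).1 le_rfl
  have hloc' : ∀ τ ∈ Icc a b, ∃ δ > 0, ∀ t ∈ Icc a b, |t - τ| < δ →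
      (t ≤ τ → P t τ) ∧ (τ ≤ t → P τ t) := by
    intro τ hτ
    obtain ⟨δ, hδ, h⟩ := Metric.eventually_nhds_iff.1 (eventually_nhdsWithin_iff.1 (hloc τ hτ))
    exact ⟨δ, hδ, fun t ht htδ => h (by rwa [Real.dist_eq]) ht⟩
  -- Demanding `P a s` for all `s` up to `x` makes `S` downward closed, so a point of the closure
  -- only needs `hloc'` at itself.
  set S : Set ℝ := {x | ∀ s ∈ Icc a x, P a s} with hS
  have hclosed : IsClosed (S ∩ Icc a b) := by
    refine isClosed_of_closure_subset fun x hx => ?_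
    have hxI : x ∈ Icc a b := isClosed_Icc.closure_subset_iff.2 inter_subset_right hx
    refine ⟨fun s hs => ?_, hxI⟩
    rcases hs.2.lt_or_eq with hsx | rfl
    · obtain ⟨t, ht, htx⟩ := Metric.mem_closure_iff.1 hx (x - s) (by linarith)
      rw [Real.dist_eq] at htx
      exact ht.1 s ⟨hs.1, by linarith [(abs_lt.1 htx).2]⟩
    · obtain ⟨δ, hδ, h⟩ := hloc' s hxI
      obtain ⟨t, ht, htx⟩ := Metric.mem_closure_iff.1 hx δ hδ
      rw [Real.dist_eq, abs_sub_comm] at htx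
      rcases le_total t s with hts | hts
      · exact htrans a t s le_rfl ht.2.1 hts hxI.2 (ht.1 t ⟨ht.2.1, le_rfl⟩)
          ((h t ht.2 htx).1 hts)
      · exact ht.1 s ⟨hs.1, hts⟩
  have hsub : Icc a b ⊆ S := by
    refine hclosed.Icc_subset_of_forall_exists_gt ?_ ?_
    · intro s hs
      obtain rfl : s = a := le_antisymm hs.2 hs.1
      exact hrefl s ⟨le_rfl, hab⟩
    · rintro x ⟨hxS, hx⟩ y hy
      have hxI : x ∈ Icc a b := ⟨hx.1, hx.2.le⟩
      obtain ⟨δ, hδ, h⟩ := hloc' x hxI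
      have hlt : x < min (min y b) (x + δ / 2) := by
        refine lt_min (lt_min hy hx.2) (by linarith)
      refine ⟨min (min y b) (x + δ / 2), fun s hs => ?_, hlt,
        (min_le_left _ _).trans (min_le_left _ _)⟩
      have h1 : s ≤ b := hs.2.trans ((min_le_left _ _).trans (min_le_right _ _))
      have h2 : s ≤ x + δ / 2 := hs.2.trans (min_le_right _ _)
      rcases le_total s x with hsx | hsx
      · exact hxS s ⟨hs.1, hsx⟩
      · refine htrans a x s le_rfl hx.1 hsx h1 (hxS x ⟨hx.1, le_rfl⟩)
          ((h s ⟨hs.1, h1⟩ ?_).2 hsx)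
        rw [abs_of_nonneg (by linarith)]; linarith
  exact hsub ⟨hab, le_rfl⟩ b ⟨hab, le_rfl⟩

/-- A function which is locally Lipschitz with respect to a monotone function is so globally. -/
theorem norm_sub_le_of_eventually {E : Type*} [NormedAddCommGroup E] {Y : ℝ → E} {V : ℝ → ℝ}
    (hV : Monotone V) {K a b : ℝ}
    (hloc : ∀ τ ∈ Icc a b, ∀ᶠ t in 𝓝[Icc a b] τ, ‖Y t - Y τ‖ ≤ K * |V t - V τ|) :
    ∀ s ∈ Icc a b, ∀ t ∈ Icc a b, ‖Y t - Y s‖ ≤ K * |V t - V s| := by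
  have key : ∀ s ∈ Icc a b, ∀ t ∈ Icc a b, s ≤ t → ‖Y t - Y s‖ ≤ K * (V t - V s) := by
    intro s hs t ht hst
    refine interval_induction (P := fun x y => ‖Y y - Y x‖ ≤ K * (V y - V x)) hst ?_ ?_
    · intro x y z _ _ _ _ h1 h2
      calc ‖Y z - Y x‖ = ‖(Y z - Y y) + (Y y - Y x)‖ := by congr 1; abel
        _ ≤ ‖Y z - Y y‖ + ‖Y y - Y x‖ := norm_add_le _ _
        _ ≤ K * (V z - V x) := by linarith
    · intro τ hτ
      have hsub : Icc s t ⊆ Icc a b := Icc_subset_Icc hs.1 ht.2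
      filter_upwards [(hloc τ (hsub hτ)).filter_mono (nhdsWithin_mono τ hsub)] with u hu
      refine ⟨fun h => ?_, fun h => ?_⟩
      · rw [abs_sub_comm, norm_sub_rev, abs_of_nonneg (sub_nonneg.2 (hV h))] at hu
        exact hu
      · rwa [abs_of_nonneg (sub_nonneg.2 (hV h))] at hu
  intro s hs t ht
  rcases le_total s t with h | h
  · rw [abs_of_nonneg (sub_nonneg.2 (hV h))]; exact key s hs t ht h
  · rw [abs_sub_comm, norm_sub_rev, abs_of_nonneg (sub_nonneg.2 (hV h))]; exact key t ht s hs h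

/-! ### Approximate solutions and their local construction. -/

section NormedRing

variable {R : Type*} [NormedRing R]

/-- `A` has increments controlled by the monotone function `V`, and its one-sided jumps at each
point, added to the identity, are invertible. -/
structure IsRegularIntegrator (A : ℝ → R) (V : ℝ → ℝ) : Prop where
  mono : Monotone V
  bound : ∀ s t, ‖A t - A s‖ ≤ |V t - V s|
  right : ∀ τ, ∃ L, Tendsto A (𝓝[>] τ) (𝓝 L) ∧ IsUnit (1 + (L - A τ))
  left : ∀ τ, ∃ L, Tendsto A (𝓝[<] τ) (𝓝 L) ∧ IsUnit (1 + (L - A τ))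

/-- `X` solves `dX = d[A] X` on `[a, b]` up to an infinitesimal relative error `ε`. -/
def IsApproxSol (A : ℝ → R) (V : ℝ → ℝ) (ε a b : ℝ) (X : ℝ → Rˣ) : Prop :=
  ∀ τ ∈ Icc a b, ∀ᶠ t in 𝓝[Icc a b] τ,
    ‖((X t * (X τ)⁻¹ : Rˣ) : R) - (1 + (A t - A τ))‖ ≤ ε * |V t - V τ|

variable {A : ℝ → R} {V : ℝ → ℝ}

theorem IsApproxSol.mono {ε ε' a b a' b' : ℝ} {X : ℝ → Rˣ} (h : IsApproxSol A V ε a b X)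
    (hε : ε ≤ ε') (ha : a ≤ a') (hb : b' ≤ b) : IsApproxSol A V ε' a' b' X := by
  intro τ hτ
  have hsub : Icc a' b' ⊆ Icc a b := Icc_subset_Icc ha hb
  filter_upwards [(h τ (hsub hτ)).filter_mono (nhdsWithin_mono τ hsub)] with t ht
  exact ht.trans (mul_le_mul_of_nonneg_right hε (abs_nonneg _))

/-- The condition involves only the ratios `X t * (X τ)⁻¹`, which right multiplication by a constant
unit leaves unchanged. So `Y` may be normalised to agree with `X` at `b`. -/
theorem IsApproxSol.glue {ε a b c : ℝ} {X Y : ℝ → Rˣ} (hX : IsApproxSol A V ε a b X)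
    (hY : IsApproxSol A V ε b c Y) (hab : a ≤ b) (hbc : b ≤ c) :
    IsApproxSol A V ε a c (fun t => if t ≤ b then X t else Y t * (Y b)⁻¹ * X b) := by
  intro τ hτ
  rcases lt_trichotomy τ b with h | rfl | h
  · have h1 := eventually_nhdsWithin_iff.1 (hX τ ⟨hτ.1, h.le⟩)
    refine eventually_nhdsWithin_iff.2 ?_
    filter_upwards [h1, Iio_mem_nhds h] with t ht htb htI
    rw [mem_Iio] at htb
    simpa only [if_pos h.le, if_pos (le_of_lt htb)] using ht ⟨htI.1, le_of_lt htb⟩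
  · rw [← Icc_union_Icc_eq_Icc hab hbc, nhdsWithin_union, eventually_sup]
    constructor
    · filter_upwards [hX τ ⟨hab, le_rfl⟩, self_mem_nhdsWithin] with t ht htI
      simpa only [if_pos le_rfl, if_pos htI.2] using ht
    · filter_upwards [hY τ ⟨le_rfl, hbc⟩, self_mem_nhdsWithin] with t ht htI
      rcases htI.1.eq_or_lt with rfl | htI'
      · simp
      · simpa only [if_pos le_rfl, if_neg (not_le.2 htI'), mul_inv_cancel_right] using ht
  · have h1 := eventually_nhdsWithin_iff.1 (hY τ ⟨h.le, hτ.2⟩)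
    refine eventually_nhdsWithin_iff.2 ?_
    filter_upwards [h1, Ioi_mem_nhds h] with t ht htb htI
    rw [mem_Ioi] at htb
    have := ht ⟨le_of_lt htb, htI.2⟩
    simpa only [if_neg (not_le.2 h), if_neg (not_le.2 htb), mul_inv_rev, inv_inv, mul_assoc,
      mul_inv_cancel_left, inv_mul_cancel_left] using this

/-- The one-sided behaviour of a regular integrator at `τ`, along the filter `l`. -/
structure HasSideLimit (A : ℝ → R) (V : ℝ → ℝ) (τ : ℝ) (l : Filter ℝ) (L : R) (v : ℝ) :
    Prop where
  tendsto : Tendsto A l (𝓝 L)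
  tendsto_var : Tendsto V l (𝓝 v)
  isUnit : IsUnit (1 + (L - A τ))
  norm_jump_le : ‖L - A τ‖ ≤ |v - V τ|
  eventually_norm_le : ∀ᶠ t in l, ‖A t - L‖ ≤ |V t - v| ∧ |V t - V τ| = |V t - v| + |v - V τ|

theorem IsRegularIntegrator.hasSideLimit_right (h : IsRegularIntegrator A V) (τ : ℝ) :
    ∃ L v, HasSideLimit A V τ (𝓝[>] τ) L v := by
  obtain ⟨L, hL, hu⟩ := h.right τ
  obtain ⟨v, hv⟩ : ∃ v, Tendsto V (𝓝[>] τ) (𝓝 v) := ⟨_, h.mono.tendsto_nhdsGT τ⟩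
  refine ⟨L, v, hL, hv, hu, ?_, ?_⟩
  · exact le_of_tendsto_of_tendsto (hL.sub_const _).norm (hv.sub_const _).abs
      (Eventually.of_forall fun t => h.bound τ t)
  · filter_upwards [self_mem_nhdsWithin] with t ht
    have h1 : V τ ≤ v := ge_of_tendsto hv (by
      filter_upwards [self_mem_nhdsWithin] with s hs using h.mono (le_of_lt hs))
    have h2 : v ≤ V t := le_of_tendsto hv (by
      filter_upwards [Ioo_mem_nhdsGT ht] with s hs using h.mono hs.2.le)
    refine ⟨?_, ?_⟩
    · exact le_of_tendsto_of_tendsto (tendsto_const_nhds.sub hL).norm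
        (tendsto_const_nhds.sub hv).abs (Eventually.of_forall fun s => h.bound s t)
    · rw [abs_of_nonneg (by linarith), abs_of_nonneg (by linarith), abs_of_nonneg (by linarith)]
      ring

theorem IsRegularIntegrator.hasSideLimit_left (h : IsRegularIntegrator A V) (τ : ℝ) :
    ∃ L v, HasSideLimit A V τ (𝓝[<] τ) L v := by
  obtain ⟨L, hL, hu⟩ := h.left τ
  obtain ⟨v, hv⟩ : ∃ v, Tendsto V (𝓝[<] τ) (𝓝 v) := ⟨_, h.mono.tendsto_nhdsLT τ⟩
  refine ⟨L, v, hL, hv, hu, ?_, ?_⟩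
  · exact le_of_tendsto_of_tendsto (hL.sub_const _).norm (hv.sub_const _).abs
      (Eventually.of_forall fun t => h.bound τ t)
  · filter_upwards [self_mem_nhdsWithin] with t ht
    have h1 : v ≤ V τ := le_of_tendsto hv (by
      filter_upwards [self_mem_nhdsWithin] with s hs using h.mono (le_of_lt hs))
    have h2 : V t ≤ v := ge_of_tendsto hv (by
      filter_upwards [Ioo_mem_nhdsLT ht] with s hs using h.mono hs.1.le)
    refine ⟨?_, ?_⟩
    · exact le_of_tendsto_of_tendsto (tendsto_const_nhds.sub hL).norm
        (tendsto_const_nhds.sub hv).abs (Eventually.of_forall fun s => h.bound s t)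
    · rw [abs_of_nonpos (by linarith), abs_of_nonpos (by linarith), abs_of_nonpos (by linarith)]
      ring

/-- A unit at distance at most `q ≤ 1/2` from `1` has its inverse within `2q` of `1`. -/
theorem Units.norm_inv_sub_one_le (u : Rˣ) {q : ℝ} (hq : q ≤ 1 / 2)
    (hu : ‖(u : R) - 1‖ ≤ q) : ‖((u⁻¹ : Rˣ) : R) - 1‖ ≤ 2 * q := by
  have e : ((u⁻¹ : Rˣ) : R) - 1 = -((((u⁻¹ : Rˣ) : R) - 1) * ((u : R) - 1)) - ((u : R) - 1) := by
    have := u.inv_mul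
    simp only [sub_mul, mul_sub, this, mul_one, one_mul]; abel
  have h2 : ‖((u⁻¹ : Rˣ) : R) - 1‖ ≤ ‖((u⁻¹ : Rˣ) : R) - 1‖ * ‖(u : R) - 1‖ + ‖(u : R) - 1‖ := by
    calc ‖((u⁻¹ : Rˣ) : R) - 1‖
        = ‖-((((u⁻¹ : Rˣ) : R) - 1) * ((u : R) - 1)) - ((u : R) - 1)‖ := congrArg _ e
      _ ≤ ‖-((((u⁻¹ : Rˣ) : R) - 1) * ((u : R) - 1))‖ + ‖(u : R) - 1‖ := norm_sub_le _ _
      _ ≤ _ := by rw [norm_neg]; gcongr; exact norm_mul_le _ _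
  have h3 := norm_nonneg (((u⁻¹ : Rˣ) : R) - 1)
  nlinarith

variable [CompleteSpace R]

/-- The approximation crosses the jump exactly and then takes one Euler step: `X τ = 1` and `X t =
(1 + (A t - L)) * (1 + (L - A τ))`. From `τ` the error is the product `(A t - L) * (L - A τ)`, whose
first factor is small near the limit. Between two points on the same side the jump factor cancels
and the error is `A t - A σ` times the distance of a near-identity inverse from 1. -/
theorem HasSideLimit.exists_approx (hA : ∀ s t, ‖A t - A s‖ ≤ |V t - V s|)
    {τ : ℝ} {l : Filter ℝ} {L : R} {v : ℝ} (h : HasSideLimit A V τ l L v)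
    (hl : ∀ᶠ t in l, t ≠ τ) {ε : ℝ} (hε : 0 < ε) :
    ∃ X : ℝ → Rˣ, ∃ J ∈ l,
      (∀ t ∈ J, ‖((X t * (X τ)⁻¹ : Rˣ) : R) - (1 + (A t - A τ))‖ ≤ ε * |V t - V τ|) ∧
      (∀ σ ∈ J, ∀ t ∈ J,
        ‖((X t * (X σ)⁻¹ : Rˣ) : R) - (1 + (A t - A σ))‖ ≤ ε * |V t - V σ|) := by
  obtain ⟨D, hD⟩ := h.isUnit
  -- The bound `1 / 2` gives access to `Units.norm_inv_sub_one_le`, whose conclusion `2 * η` must be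
  -- at most `ε`.
  set η : ℝ := min (1 / 2) (ε / 2) with hη
  have hη0 : 0 < η := lt_min (by norm_num) (by linarith)
  have hη1 : η ≤ 1 / 2 := min_le_left _ _
  have hη2 : 2 * η ≤ ε := by linarith [min_le_right (1 / 2) (ε / 2)]
  have hVs : ∀ᶠ t in l, |V t - v| < η := by
    filter_upwards [h.tendsto_var (Metric.ball_mem_nhds v hη0)] with t ht
    rwa [← Real.dist_eq]
  set J : Set ℝ := {t | t ≠ τ ∧ ‖A t - L‖ ≤ η ∧ ‖A t - L‖ ≤ |V t - v| ∧
    |V t - V τ| = |V t - v| + |v - V τ|} with hJ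
  have hJl : J ∈ l := by
    filter_upwards [hl, hVs, h.eventually_norm_le] with t a1 a2 a3
    exact ⟨a1, a3.1.trans a2.le, a3.1, a3.2⟩
  have hunit : ∀ t, ∃ u : Rˣ, t ∈ J → (u : R) = 1 + (A t - L) := by
    intro t
    by_cases ht : t ∈ J
    · have : ‖-(A t - L)‖ < 1 := by rw [norm_neg]; linarith [ht.2.1]
      exact ⟨Units.oneSub _ this, fun _ => by rw [Units.val_oneSub]; abel⟩
    · exact ⟨1, fun h => absurd h ht⟩
  choose u hu using hunit
  have hτJ : τ ∉ J := fun h => h.1 rfl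
  classical
  refine ⟨fun t => if t = τ then 1 else u t * D, J, hJl, ?_, ?_⟩
  · intro t ht
    simp only [if_neg ht.1, if_true, inv_one, mul_one, Units.val_mul, hD, hu t ht]
    have e : (1 + (A t - L)) * (1 + (L - A τ)) - (1 + (A t - A τ)) = (A t - L) * (L - A τ) := by
      noncomm_ring
    rw [e, ht.2.2.2]
    calc ‖(A t - L) * (L - A τ)‖ ≤ ‖A t - L‖ * ‖L - A τ‖ := norm_mul_le _ _
      _ ≤ η * |v - V τ| := mul_le_mul ht.2.1 h.norm_jump_le (norm_nonneg _) hη0.le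
      _ ≤ ε * (|V t - v| + |v - V τ|) := by
        refine mul_le_mul (by linarith) (by linarith [abs_nonneg (V t - v)]) (abs_nonneg _) hε.le
  · intro σ hσ t ht
    simp only [if_neg ht.1, if_neg hσ.1]
    have e0 : u t * D * (u σ * D)⁻¹ = u t * (u σ)⁻¹ := by
      rw [mul_inv_rev, mul_assoc, mul_inv_cancel_left]
    have e1 : (u t : R) = u σ + (A t - A σ) := by rw [hu t ht, hu σ hσ]; abel
    have e2 : ((u t * (u σ)⁻¹ : Rˣ) : R) - (1 + (A t - A σ))
        = (A t - A σ) * (((u σ)⁻¹ : Rˣ) - 1) := by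
      rw [Units.val_mul, e1, add_mul, Units.mul_inv, mul_sub, mul_one]; abel
    rw [e0, e2]
    have h3 := Units.norm_inv_sub_one_le (u σ) hη1 (by rw [hu σ hσ]; simpa using hσ.2.1)
    calc _ ≤ ‖A t - A σ‖ * ‖(((u σ)⁻¹ : Rˣ) : R) - 1‖ := norm_mul_le _ _
      _ ≤ |V t - V σ| * ε :=
        mul_le_mul (hA σ t) (h3.trans hη2) (norm_nonneg _) (abs_nonneg _)
      _ = _ := mul_comm _ _

theorem IsRegularIntegrator.exists_isApproxSol (h : IsRegularIntegrator A V)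
    {ε : ℝ} (hε : 0 < ε) {a b : ℝ} (hab : a ≤ b) :
    ∃ X, IsApproxSol A V ε a b X := by
  refine interval_induction (P := fun x y => ∃ X, IsApproxSol A V ε x y X) hab ?_ ?_
  · rintro x y z _ hxy hyz _ ⟨X, hX⟩ ⟨Y, hY⟩
    exact ⟨_, hX.glue hY hxy hyz⟩
  · intro τ _
    refine nhdsWithin_le_nhds ?_
    have hR : ∀ᶠ t in 𝓝[>] τ, ∃ X, IsApproxSol A V ε τ t X := by
      obtain ⟨L, v, hs⟩ := h.hasSideLimit_right τ
      obtain ⟨X, J, hJ, hX1, hX2⟩ := hs.exists_approx h.bound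
        (by filter_upwards [self_mem_nhdsWithin] with t ht using ne_of_gt ht) hε
      obtain ⟨β, hβ, hβJ⟩ := (mem_nhdsGT_iff_exists_Ioo_subset).1 hJ
      filter_upwards [Ioo_mem_nhdsGT hβ] with t ht
      refine ⟨X, fun σ hσ => ?_⟩
      rcases hσ.1.eq_or_lt with rfl | hσ'
      · filter_upwards [self_mem_nhdsWithin] with s hs
        rcases hs.1.eq_or_lt with rfl | hs'
        · simp
        · exact hX1 s (hβJ ⟨hs', hs.2.trans_lt ht.2⟩)
      · refine eventually_nhdsWithin_iff.2 ?_
        filter_upwards [Ioi_mem_nhds hσ'] with s hs hs'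
        exact hX2 σ (hβJ ⟨hσ', hσ.2.trans_lt ht.2⟩) s (hβJ ⟨hs, hs'.2.trans_lt ht.2⟩)
    have hL : ∀ᶠ t in 𝓝[<] τ, ∃ X, IsApproxSol A V ε t τ X := by
      obtain ⟨L, v, hs⟩ := h.hasSideLimit_left τ
      obtain ⟨X, J, hJ, hX1, hX2⟩ := hs.exists_approx h.bound
        (by filter_upwards [self_mem_nhdsWithin] with t ht using ne_of_lt ht) hε
      obtain ⟨β, hβ, hβJ⟩ := (mem_nhdsLT_iff_exists_Ioo_subset).1 hJ
      filter_upwards [Ioo_mem_nhdsLT hβ] with t ht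
      refine ⟨X, fun σ hσ => ?_⟩
      rcases hσ.2.eq_or_lt with rfl | hσ'
      · filter_upwards [self_mem_nhdsWithin] with s hs
        rcases hs.2.eq_or_lt with rfl | hs'
        · simp
        · exact hX1 s (hβJ ⟨ht.1.trans_le hs.1, hs'⟩)
      · refine eventually_nhdsWithin_iff.2 ?_
        filter_upwards [Iio_mem_nhds hσ'] with s hs hs'
        exact hX2 σ (hβJ ⟨ht.1.trans_le hσ.1, hσ'⟩) s (hβJ ⟨ht.1.trans_le hs'.1, hs⟩)
    have hself : ∃ X, IsApproxSol A V ε τ τ X := by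
      refine ⟨fun _ => 1, fun σ hσ => ?_⟩
      filter_upwards [self_mem_nhdsWithin] with s hs
      obtain rfl : s = σ := by rw [Icc_self] at hs hσ; exact hs.trans hσ.symm
      simp
    filter_upwards [eventually_nhdsWithin_iff.1 hR, eventually_nhdsWithin_iff.1 hL] with t hr hl
    refine ⟨fun ht => ?_, fun ht => ?_⟩
    · rcases ht.eq_or_lt with rfl | ht
      exacts [hself, hl ht]
    · rcases ht.eq_or_lt with rfl | ht
      exacts [hself, hr ht]

end NormedRing

/-! ### Uniform bounds and comparison of approximate solutions. -/

section NormedRing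

variable {R : Type*} [NormedRing R] {A : ℝ → R} {V : ℝ → ℝ}

/-- Gronwall estimate on an interval where the control function varies little. -/
theorem IsApproxSol.norm_le_exp (h1 : ‖(1 : R)‖ ≤ 1) (hV : Monotone V)
    (hA : ∀ s t, ‖A t - A s‖ ≤ |V t - V s|) {a b : ℝ} (hab : a ≤ b) {X : ℝ → Rˣ}
    (hX : IsApproxSol A V 1 a b X) (hsmall : V b - V a ≤ 1 / 4) :
    ‖((X b * (X a)⁻¹ : Rˣ) : R)‖ ≤ Real.exp (4 * (V b - V a)) ∧
      ‖((X a * (X b)⁻¹ : Rˣ) : R)‖ ≤ Real.exp (4 * (V b - V a)) := by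
  refine interval_induction (P := fun x y =>
    ‖((X y * (X x)⁻¹ : Rˣ) : R)‖ ≤ Real.exp (4 * (V y - V x)) ∧
      ‖((X x * (X y)⁻¹ : Rˣ) : R)‖ ≤ Real.exp (4 * (V y - V x))) hab ?_ ?_
  · rintro x y z _ _ _ _ ⟨p1, p2⟩ ⟨q1, q2⟩
    have e : Real.exp (4 * (V z - V x))
        = Real.exp (4 * (V z - V y)) * Real.exp (4 * (V y - V x)) := by
      rw [← Real.exp_add]; ring_nf
    constructor
    · have e1 : X z * (X x)⁻¹ = (X z * (X y)⁻¹) * (X y * (X x)⁻¹) := by group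
      rw [e1, Units.val_mul, e]
      exact (norm_mul_le _ _).trans (mul_le_mul q1 p1 (norm_nonneg _) (Real.exp_nonneg _))
    · have e1 : X x * (X z)⁻¹ = (X x * (X y)⁻¹) * (X y * (X z)⁻¹) := by group
      rw [e1, Units.val_mul, e, mul_comm (Real.exp _)]
      exact (norm_mul_le _ _).trans (mul_le_mul p2 q2 (norm_nonneg _) (Real.exp_nonneg _))
  · intro τ hτ
    have key : ∀ᶠ t in 𝓝[Icc a b] τ,
        ‖((X t * (X τ)⁻¹ : Rˣ) : R)‖ ≤ Real.exp (4 * |V t - V τ|) ∧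
        ‖((X τ * (X t)⁻¹ : Rˣ) : R)‖ ≤ Real.exp (4 * |V t - V τ|) := by
      filter_upwards [hX τ hτ, self_mem_nhdsWithin] with t ht htI
      set d := |V t - V τ| with hd
      have hd0 : 0 ≤ d := abs_nonneg _
      have hd1 : d ≤ 1 / 4 := by
        have m1 := hV hτ.1; have m2 := hV hτ.2; have m3 := hV htI.1; have m4 := hV htI.2
        rw [hd, abs_le]; constructor <;> linarith
      have hq : ‖((X t * (X τ)⁻¹ : Rˣ) : R) - 1‖ ≤ 2 * d := by
        calc _ = ‖(((X t * (X τ)⁻¹ : Rˣ) : R) - (1 + (A t - A τ))) + (A t - A τ)‖ := by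
              congr 1; abel
          _ ≤ 1 * d + d := (norm_add_le _ _).trans (add_le_add ht (hA τ t))
          _ = 2 * d := by ring
      -- The smallness `1 / 4` ensures `2 * d ≤ 1 / 2`. Inversion doubles `2 * d`, whence the
      -- constant 4 in the exponent.
      have hq' := Units.norm_inv_sub_one_le _ (by linarith) hq
      rw [mul_inv_rev, inv_inv] at hq'
      have bd : ∀ w : R, ‖w - 1‖ ≤ 4 * d → ‖w‖ ≤ Real.exp (4 * d) := by
        intro w hw
        calc ‖w‖ = ‖(w - 1) + 1‖ := by rw [sub_add_cancel]
          _ ≤ 4 * d + 1 := (norm_add_le _ _).trans (add_le_add hw h1)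
          _ ≤ _ := Real.add_one_le_exp _
      exact ⟨bd _ (by linarith), bd _ (by linarith)⟩
    filter_upwards [key] with t ht
    refine ⟨fun h => ?_, fun h => ?_⟩
    · rw [abs_sub_comm, abs_of_nonneg (sub_nonneg.2 (hV h))] at ht
      exact ht.symm
    · rwa [abs_of_nonneg (sub_nonneg.2 (hV h))] at ht

/-- Two approximate solutions with bounded transition operators have nearby transition
operators. -/
theorem IsApproxSol.norm_transition_sub_le (hV : Monotone V) {a b C ε ε' : ℝ} {X Y : ℝ → Rˣ}
    (hX : IsApproxSol A V ε a b X) (hY : IsApproxSol A V ε' a b Y) (hab : a ≤ b)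
    (hXC : ∀ s ∈ Icc a b, ∀ t ∈ Icc a b, ‖((X t * (X s)⁻¹ : Rˣ) : R)‖ ≤ C)
    (hYC : ∀ s ∈ Icc a b, ∀ t ∈ Icc a b, ‖((Y t * (Y s)⁻¹ : Rˣ) : R)‖ ≤ C)
    {s t : ℝ} (hs : s ∈ Icc a b) (ht : t ∈ Icc a b) :
    ‖((Y t * (Y s)⁻¹ : Rˣ) : R) - ((X t * (X s)⁻¹ : Rˣ) : R)‖
      ≤ C ^ 4 * (ε + ε') * |V t - V s| := by
  have haI : a ∈ Icc a b := ⟨le_rfl, hab⟩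
  have hC : 0 ≤ C := (norm_nonneg _).trans (hXC a haI a haI)
  -- Variation of constants: `Z` compares `Y` with `X` in the frame at `a`. It would be constant if
  -- both were exact, and its local increments are of size `ε + ε'`.
  set Z : ℝ → R := fun t => ((X a * (X t)⁻¹ * (Y t * (Y a)⁻¹) : Rˣ) : R) with hZ
  have sandwich : ∀ p q : ℝ, Z p - Z q = ((X a * (X p)⁻¹ : Rˣ) : R) *
      (((Y p * (Y q)⁻¹ : Rˣ) : R) - ((X p * (X q)⁻¹ : Rˣ) : R)) *
        ((Y q * (Y a)⁻¹ : Rˣ) : R) := by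
    intro p q
    simp only [hZ, mul_sub, sub_mul, ← Units.val_mul]
    refine congrArg₂ (· - ·) (congrArg Units.val ?_) (congrArg Units.val ?_) <;> group
  have hloc := norm_sub_le_of_eventually (Y := Z) (K := C ^ 2 * (ε + ε')) hV (a := a) (b := b) (by
    intro τ hτ
    filter_upwards [hX τ hτ, hY τ hτ, self_mem_nhdsWithin] with u p q huI
    rw [sandwich]
    have d : ‖((Y u * (Y τ)⁻¹ : Rˣ) : R) - ((X u * (X τ)⁻¹ : Rˣ) : R)‖
        ≤ (ε + ε') * |V u - V τ| := by
      calc _ = ‖(((Y u * (Y τ)⁻¹ : Rˣ) : R) - (1 + (A u - A τ)))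
            - (((X u * (X τ)⁻¹ : Rˣ) : R) - (1 + (A u - A τ)))‖ := by congr 1; abel
        _ ≤ _ := (norm_sub_le _ _).trans (by linarith)
    calc _ ≤ C * ((ε + ε') * |V u - V τ|) * C := by
          refine (norm_mul_le _ _).trans (mul_le_mul ((norm_mul_le _ _).trans
            (mul_le_mul (hXC u huI a haI) d (norm_nonneg _) hC)) (hYC a haI τ hτ)
            (norm_nonneg _) (mul_nonneg hC ((norm_nonneg _).trans d)))
      _ = _ := by ring) s hs t ht
  have e : ((Y t * (Y s)⁻¹ : Rˣ) : R) - ((X t * (X s)⁻¹ : Rˣ) : R)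
      = ((X t * (X a)⁻¹ : Rˣ) : R) * (Z t - Z s) * ((Y a * (Y s)⁻¹ : Rˣ) : R) := by
    simp only [hZ, mul_sub, sub_mul, ← Units.val_mul]
    refine congrArg₂ (· - ·) (congrArg Units.val ?_) (congrArg Units.val ?_) <;> group
  rw [e]
  calc _ ≤ C * (C ^ 2 * (ε + ε') * |V t - V s|) * C := by
        refine (norm_mul_le _ _).trans (mul_le_mul ((norm_mul_le _ _).trans
          (mul_le_mul (hXC a haI t ht) hloc (norm_nonneg _) hC)) (hYC s hs a haI)
          (norm_nonneg _) (mul_nonneg hC ((norm_nonneg _).trans hloc)))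
    _ = _ := by ring

/-- Bounds on the transition operators on a punctured one-sided interval and near the puncture
give a bound on the whole interval. -/
theorem norm_transition_le_of_puncture {X : ℝ → Rˣ} {τ C₀ C₁ : ℝ} {J : Set ℝ}
    (h1 : ‖(1 : R)‖ ≤ 1) (hC₀ : 1 ≤ C₀) (hC₁ : 1 ≤ C₁)
    (hJ : ∀ s ∈ J, ∀ t ∈ J, ‖((X t * (X s)⁻¹ : Rˣ) : R)‖ ≤ C₀) {u : ℝ} (hu : u ∈ J)
    (hu1 : ‖((X u * (X τ)⁻¹ : Rˣ) : R)‖ ≤ C₁) (hu2 : ‖(((X u * (X τ)⁻¹)⁻¹ : Rˣ) : R)‖ ≤ C₁) :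
    ∀ s ∈ insert τ J, ∀ t ∈ insert τ J, ‖((X t * (X s)⁻¹ : Rˣ) : R)‖ ≤ C₀ * C₁ := by
  have hC : 1 ≤ C₀ * C₁ := one_le_mul_of_one_le_of_one_le hC₀ hC₁
  rintro s (rfl | hs) t (rfl | ht)
  · simpa using h1.trans hC
  · have e : X t * (X s)⁻¹ = (X t * (X u)⁻¹) * (X u * (X s)⁻¹) := by group
    rw [e, Units.val_mul]
    exact (norm_mul_le _ _).trans (mul_le_mul (hJ u hu t ht) hu1 (norm_nonneg _) (by linarith))
  · have e : X t * (X s)⁻¹ = (X u * (X t)⁻¹)⁻¹ * (X u * (X s)⁻¹) := by group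
    rw [e, Units.val_mul, mul_comm C₀]
    exact (norm_mul_le _ _).trans (mul_le_mul hu2 (hJ s hs u hu) (norm_nonneg _) (by linarith))
  · exact (hJ s hs t ht).trans (le_mul_of_one_le_right (by linarith) hC₁)

variable [CompleteSpace R]

/-- Near the jump, `U t` lies in a small ball around the unit `1 + (L - A τ)`, where the norm and
the inverse are bounded by continuity. The error `ε` must be small relative to the size of the jump
of `V`, or `U t` could leave that ball. -/
theorem HasSideLimit.exists_bound {τ : ℝ} {l : Filter ℝ} {L : R} {v : ℝ}
    (h : HasSideLimit A V τ l L v) :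
    ∃ ε > 0, ε ≤ 1 ∧ ∃ C, ∀ U : ℝ → Rˣ,
      (∀ᶠ t in l, ‖(U t : R) - (1 + (A t - A τ))‖ ≤ ε * |V t - V τ|) →
      ∀ᶠ t in l, ‖(U t : R)‖ ≤ C ∧ ‖(((U t)⁻¹ : Rˣ) : R)‖ ≤ C := by
  obtain ⟨D, hD⟩ := h.isUnit
  have hinv : ∀ᶠ w in 𝓝 (D : R), ‖Ring.inverse w‖ < ‖Ring.inverse (D : R)‖ + 1 :=
    (NormedRing.inverse_continuousAt D).norm.eventually_lt_const (by linarith)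
  have hnorm : ∀ᶠ w in 𝓝 (D : R), ‖w‖ < ‖(D : R)‖ + 1 :=
    continuous_norm.continuousAt.eventually_lt_const (by linarith)
  obtain ⟨r, hr, hball⟩ := Metric.eventually_nhds_iff.1 (hinv.and hnorm)
  set w := |v - V τ| with hw
  have hw0 : 0 ≤ w := abs_nonneg _
  refine ⟨min 1 (r / 2 / (w + 1)), lt_min one_pos (by positivity), min_le_left _ _,
    max (‖(D : R)‖ + 1) (‖Ring.inverse (D : R)‖ + 1), fun U hU => ?_⟩
  have t1 : ∀ᶠ t in l, ‖A t - L‖ < r / 2 := by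
    filter_upwards [h.tendsto (Metric.ball_mem_nhds L (half_pos hr))] with t ht
    rwa [← dist_eq_norm]
  have t2 : ∀ᶠ t in l, |V t - V τ| < w + 1 :=
    (h.tendsto_var.sub_const _).abs.eventually_lt_const (by linarith)
  filter_upwards [hU, t1, t2] with t hU t1 t2
  have hd : dist (U t : R) D < r := by
    rw [dist_eq_norm, hD]
    calc _ = ‖((U t : R) - (1 + (A t - A τ))) + (A t - L)‖ := by congr 1; abel
      _ ≤ min 1 (r / 2 / (w + 1)) * |V t - V τ| + ‖A t - L‖ :=
        (norm_add_le _ _).trans (by gcongr)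
      _ ≤ r / 2 / (w + 1) * (w + 1) + ‖A t - L‖ := by
        gcongr; exact min_le_right _ _
      _ = r / 2 + ‖A t - L‖ := by rw [div_mul_cancel₀ _ (by positivity)]
      _ < r := by linarith
  have := hball hd
  rw [Ring.inverse_unit] at this
  exact ⟨this.2.le.trans (le_max_left _ _), this.1.le.trans (le_max_right _ _)⟩

/-- On either side of `τ`, with `τ` itself removed, `V` varies by less than `1 / 4` nearby, so the
Gronwall bound gives `exp 1`. The jump at `τ` is handled by `HasSideLimit.exists_bound`. Cousin's
lemma then yields one `ε` and one `C` valid for every approximate solution. -/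
theorem IsRegularIntegrator.exists_transition_bound (h : IsRegularIntegrator A V)
    (h1 : ‖(1 : R)‖ ≤ 1) {a b : ℝ} (hab : a ≤ b) :
    ∃ ε > 0, ∃ C, 1 ≤ C ∧ ∀ X, IsApproxSol A V ε a b X →
      ∀ s ∈ Icc a b, ∀ t ∈ Icc a b, ‖((X t * (X s)⁻¹ : Rˣ) : R)‖ ≤ C := by
  refine interval_induction (P := fun a b => ∃ ε > 0, ∃ C, 1 ≤ C ∧ ∀ X, IsApproxSol A V ε a b X →
      ∀ s ∈ Icc a b, ∀ t ∈ Icc a b, ‖((X t * (X s)⁻¹ : Rˣ) : R)‖ ≤ C) hab ?_ ?_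
  · rintro x y z _ hxy hyz _ ⟨ε, hε, C, hC, hX⟩ ⟨ε', hε', C', hC', hX'⟩
    refine ⟨min ε ε', lt_min hε hε', C * C', one_le_mul_of_one_le_of_one_le hC hC', ?_⟩
    intro X hs
    have B1 := hX X (hs.mono (min_le_left _ _) le_rfl hyz)
    have B2 := hX' X (hs.mono (min_le_right _ _) hxy le_rfl)
    have split : ∀ s ∈ Icc x z, ∀ t ∈ Icc x z,
        ‖((X t * (X s)⁻¹ : Rˣ) : R)‖ ≤ C * C' := by
      have e : ∀ s t, X t * (X s)⁻¹ = (X t * (X y)⁻¹) * (X y * (X s)⁻¹) := by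
        intro s t; group
      intro s hs t ht
      rcases le_total s y with hsy | hsy <;> rcases le_total t y with hty | hty
      · exact (B1 s ⟨hs.1, hsy⟩ t ⟨ht.1, hty⟩).trans (le_mul_of_one_le_right (by linarith) hC')
      · rw [e, Units.val_mul, mul_comm C]
        exact (norm_mul_le _ _).trans (mul_le_mul (B2 y ⟨le_rfl, hyz⟩ t ⟨hty, ht.2⟩)
          (B1 s ⟨hs.1, hsy⟩ y ⟨hxy, le_rfl⟩) (norm_nonneg _) (by linarith))
      · rw [e, Units.val_mul]
        exact (norm_mul_le _ _).trans (mul_le_mul (B1 y ⟨hxy, le_rfl⟩ t ⟨ht.1, hty⟩)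
          (B2 s ⟨hsy, hs.2⟩ y ⟨le_rfl, hyz⟩) (norm_nonneg _) (by linarith))
      · exact (B2 s ⟨hsy, hs.2⟩ t ⟨hty, ht.2⟩).trans (le_mul_of_one_le_left (by linarith) hC)
    exact split
  · intro τ _
    refine nhdsWithin_le_nhds ?_
    have hpair : ∀ {p q : ℝ} {X : ℝ → Rˣ}, p ≤ q → IsApproxSol A V 1 p q X →
        V q - V p ≤ 1 / 4 → ‖((X q * (X p)⁻¹ : Rˣ) : R)‖ ≤ Real.exp 1 ∧
          ‖((X p * (X q)⁻¹ : Rˣ) : R)‖ ≤ Real.exp 1 := by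
      intro p q X hpq hX hs
      have := hX.norm_le_exp h1 h.mono h.bound hpq hs
      have hle : Real.exp (4 * (V q - V p)) ≤ Real.exp 1 := Real.exp_le_exp.2 (by linarith)
      exact ⟨this.1.trans hle, this.2.trans hle⟩
    have hR : ∀ᶠ r in 𝓝[>] τ, ∃ ε > 0, ∃ C, 1 ≤ C ∧ ∀ X, IsApproxSol A V ε τ r X →
        ∀ s ∈ Icc τ r, ∀ t ∈ Icc τ r, ‖((X t * (X s)⁻¹ : Rˣ) : R)‖ ≤ C := by
      obtain ⟨L, v, hs⟩ := h.hasSideLimit_right τ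
      obtain ⟨ε, hε, hε1, C, hC⟩ := hs.exists_bound
      obtain ⟨β, hβ, hβJ⟩ := (mem_nhdsGT_iff_exists_Ioo_subset).1
        (hs.tendsto_var (Metric.ball_mem_nhds v (by norm_num : (0 : ℝ) < 1 / 8)))
      filter_upwards [Ioo_mem_nhdsGT hβ] with r hr
      refine ⟨ε, hε, Real.exp 1 * max C 1,
        one_le_mul_of_one_le_of_one_le (Real.one_le_exp (by norm_num)) (le_max_right _ _),
        fun X hX => ?_⟩
      have hev := hC (fun t => X t * (X τ)⁻¹) (by
        have := (hX τ ⟨le_rfl, hr.1.le⟩)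
        rw [← nhdsWithin_Ioc_eq_nhdsGT hr.1]
        exact this.filter_mono (nhdsWithin_mono _ Ioc_subset_Icc_self))
      obtain ⟨u, ⟨hu1, hu2⟩, huI⟩ := (hev.and (Ioo_mem_nhdsGT hr.1)).exists
      have hI : insert τ (Ioc τ r) = Icc τ r := Ioc_insert_left hr.1.le
      rw [← hI]
      refine norm_transition_le_of_puncture h1 (Real.one_le_exp (by norm_num)) (le_max_right _ _)
        ?_ ⟨huI.1, huI.2.le⟩ (hu1.trans (le_max_left _ _)) (hu2.trans (le_max_left _ _))
      have hvar : ∀ p ∈ Ioc τ r, ∀ q ∈ Ioc τ r, V q - V p ≤ 1 / 4 := by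
        intro p hp q hq
        have b1 := hβJ ⟨hp.1, hp.2.trans_lt hr.2⟩
        have b2 := hβJ ⟨hq.1, hq.2.trans_lt hr.2⟩
        rw [mem_preimage, Metric.mem_ball, Real.dist_eq, abs_lt] at b1 b2
        linarith
      intro s hs t ht
      rcases le_total s t with hst | hst
      · exact (hpair hst (hX.mono hε1 hs.1.le ht.2) (hvar s hs t ht)).1
      · exact (hpair hst (hX.mono hε1 ht.1.le hs.2) (hvar t ht s hs)).2
    have hL : ∀ᶠ r in 𝓝[<] τ, ∃ ε > 0, ∃ C, 1 ≤ C ∧ ∀ X, IsApproxSol A V ε r τ X →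
        ∀ s ∈ Icc r τ, ∀ t ∈ Icc r τ, ‖((X t * (X s)⁻¹ : Rˣ) : R)‖ ≤ C := by
      obtain ⟨L, v, hs⟩ := h.hasSideLimit_left τ
      obtain ⟨ε, hε, hε1, C, hC⟩ := hs.exists_bound
      obtain ⟨β, hβ, hβJ⟩ := (mem_nhdsLT_iff_exists_Ioo_subset).1
        (hs.tendsto_var (Metric.ball_mem_nhds v (by norm_num : (0 : ℝ) < 1 / 8)))
      filter_upwards [Ioo_mem_nhdsLT hβ] with r hr
      refine ⟨ε, hε, Real.exp 1 * max C 1,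
        one_le_mul_of_one_le_of_one_le (Real.one_le_exp (by norm_num)) (le_max_right _ _),
        fun X hX => ?_⟩
      have hev := hC (fun t => X t * (X τ)⁻¹) (by
        have := (hX τ ⟨hr.2.le, le_rfl⟩)
        rw [← nhdsWithin_Ico_eq_nhdsLT hr.2]
        exact this.filter_mono (nhdsWithin_mono _ Ico_subset_Icc_self))
      obtain ⟨u, ⟨hu1, hu2⟩, huI⟩ := (hev.and (Ioo_mem_nhdsLT hr.2)).exists
      have hI : insert τ (Ico r τ) = Icc r τ := Ico_insert_right hr.2.le
      rw [← hI]
      refine norm_transition_le_of_puncture h1 (Real.one_le_exp (by norm_num)) (le_max_right _ _)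
        ?_ ⟨huI.1.le, huI.2⟩ (hu1.trans (le_max_left _ _)) (hu2.trans (le_max_left _ _))
      have hvar : ∀ p ∈ Ico r τ, ∀ q ∈ Ico r τ, V q - V p ≤ 1 / 4 := by
        intro p hp q hq
        have b1 := hβJ ⟨hr.1.trans_le hp.1, hp.2⟩
        have b2 := hβJ ⟨hr.1.trans_le hq.1, hq.2⟩
        rw [mem_preimage, Metric.mem_ball, Real.dist_eq, abs_lt] at b1 b2
        linarith
      intro s hs t ht
      rcases le_total s t with hst | hst
      · exact (hpair hst (hX.mono hε1 hs.1 ht.2.le) (hvar s hs t ht)).1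
      · exact (hpair hst (hX.mono hε1 ht.1 hs.2.le) (hvar t ht s hs)).2
    have hself : ∃ ε > 0, ∃ C, 1 ≤ C ∧ ∀ X, IsApproxSol A V ε τ τ X →
        ∀ s ∈ Icc τ τ, ∀ t ∈ Icc τ τ, ‖((X t * (X s)⁻¹ : Rˣ) : R)‖ ≤ C := by
      refine ⟨1, one_pos, 1, le_rfl, fun X _ s hs t ht => ?_⟩
      rw [Icc_self, mem_singleton_iff] at hs ht
      simpa [hs, ht] using h1
    filter_upwards [eventually_nhdsWithin_iff.1 hR, eventually_nhdsWithin_iff.1 hL] with t hr hl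
    refine ⟨fun ht => ?_, fun ht => ?_⟩
    · rcases ht.eq_or_lt with rfl | ht
      exacts [hself, hl ht]
    · rcases ht.eq_or_lt with rfl | ht
      exacts [hself, hr ht]

end NormedRing

/-! ### Exact solutions as limits of approximate ones. -/

section NormedRing

variable {R : Type*} [NormedRing R] [CompleteSpace R] {A : ℝ → R} {V : ℝ → ℝ}

theorem IsRegularIntegrator.exists_sol_Icc (h : IsRegularIntegrator A V)
    (h1 : ‖(1 : R)‖ ≤ 1) {a b : ℝ} (hab : a ≤ b) :
    ∃ X : ℝ → Rˣ, ∀ ε > 0, IsApproxSol A V ε a b X := by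
  obtain ⟨ε₀, hε₀, C, hC1, hC⟩ := h.exists_transition_bound h1 hab
  have hex : ∀ k : ℕ, ∃ X, IsApproxSol A V (min ε₀ (1 / ((k : ℝ) + 1))) a b X := fun k =>
    h.exists_isApproxSol (lt_min hε₀ (by positivity)) hab
  choose X hX using hex
  set e : ℕ → ℝ := fun k => 1 / ((k : ℝ) + 1) with he
  have he0 : Tendsto e atTop (𝓝 0) := tendsto_one_div_add_atTop_nhds_zero_nat
  have hXe : ∀ k, IsApproxSol A V (e k) a b (X k) := fun k =>
    (hX k).mono (min_le_right _ _) le_rfl le_rfl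
  have hXC : ∀ k, ∀ s ∈ Icc a b, ∀ t ∈ Icc a b, ‖((X k t * (X k s)⁻¹ : Rˣ) : R)‖ ≤ C := fun k =>
    hC _ ((hX k).mono (min_le_left _ _) le_rfl le_rfl)
  have hdiff : ∀ k m, ∀ s ∈ Icc a b, ∀ t ∈ Icc a b,
      ‖((X m t * (X m s)⁻¹ : Rˣ) : R) - ((X k t * (X k s)⁻¹ : Rˣ) : R)‖
        ≤ C ^ 4 * (e k + e m) * |V t - V s| := fun k m s hs t ht =>
    (hXe k).norm_transition_sub_le h.mono (hXe m) hab (hXC k) (hXC m) hs ht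
  have hlim : ∀ s ∈ Icc a b, ∀ t ∈ Icc a b, ∃ u : R,
      Tendsto (fun k => ((X k t * (X k s)⁻¹ : Rˣ) : R)) atTop (𝓝 u) := by
    intro s hs t ht
    refine cauchySeq_tendsto_of_complete (Metric.cauchySeq_iff'.2 fun ε hε => ?_)
    have hK : Tendsto (fun N => C ^ 4 * (e N + e N) * |V t - V s|) atTop (𝓝 0) := by
      simpa using ((he0.add he0).const_mul (C ^ 4)).mul_const |V t - V s|
    obtain ⟨N, hN⟩ := (hK.eventually_lt_const hε).exists
    refine ⟨N, fun k hk => ?_⟩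
    rw [dist_eq_norm]
    refine ((hdiff N k s hs t ht).trans ?_).trans_lt hN
    have : e k ≤ e N := one_div_le_one_div_of_le (by positivity) (by gcongr)
    gcongr
  have haI : a ∈ Icc a b := ⟨le_rfl, hab⟩
  -- Forward and backward transition operators converge separately. Their limits are mutually
  -- inverse, so the limit stays in the group of units.
  have hunit : ∀ t, ∃ u : Rˣ, t ∈ Icc a b →
      Tendsto (fun k => ((X k t * (X k a)⁻¹ : Rˣ) : R)) atTop (𝓝 (u : R)) ∧
      Tendsto (fun k => ((X k a * (X k t)⁻¹ : Rˣ) : R)) atTop (𝓝 ((u⁻¹ : Rˣ) : R)) := by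
    intro t
    by_cases ht : t ∈ Icc a b
    · obtain ⟨u, hu⟩ := hlim a haI t ht
      obtain ⟨w, hw⟩ := hlim t ht a haI
      have huw : u * w = 1 := by
        refine tendsto_nhds_unique (hu.mul hw) (tendsto_const_nhds.congr fun k => ?_)
        rw [← Units.val_mul, ← Units.val_one]; congr 1; group
      have hwu : w * u = 1 := by
        refine tendsto_nhds_unique (hw.mul hu) (tendsto_const_nhds.congr fun k => ?_)
        rw [← Units.val_mul, ← Units.val_one]; congr 1; group
      exact ⟨⟨u, w, huw, hwu⟩, fun _ => ⟨hu, hw⟩⟩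
    · exact ⟨1, fun h => absurd h ht⟩
  choose Y hY using hunit
  refine ⟨Y, fun ε hε τ hτ => ?_⟩
  have hclose : ∀ k, ∀ t ∈ Icc a b,
      ‖((Y t * (Y τ)⁻¹ : Rˣ) : R) - ((X k t * (X k τ)⁻¹ : Rˣ) : R)‖
        ≤ C ^ 4 * e k * |V t - V τ| := by
    intro k t ht
    have l1 : Tendsto (fun m => ((X m t * (X m τ)⁻¹ : Rˣ) : R)) atTop
        (𝓝 ((Y t * (Y τ)⁻¹ : Rˣ) : R)) := by
      rw [Units.val_mul]
      refine ((hY t ht).1.mul (hY τ hτ).2).congr fun m => ?_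
      rw [← Units.val_mul]; congr 1; group
    have l2 : Tendsto (fun m => C ^ 4 * (e k + e m) * |V t - V τ|) atTop
        (𝓝 (C ^ 4 * (e k + 0) * |V t - V τ|)) :=
      ((he0.const_add (e k)).const_mul _).mul_const _
    rw [add_zero] at l2
    exact le_of_tendsto_of_tendsto (l1.sub_const _).norm l2
      (Eventually.of_forall fun m => hdiff k m τ hτ t ht)
  have hK : Tendsto (fun N => C ^ 4 * e N + e N) atTop (𝓝 0) := by
    simpa using (he0.const_mul (C ^ 4)).add he0
  obtain ⟨k, hk⟩ := (hK.eventually_lt_const hε).exists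
  filter_upwards [hXe k τ hτ, self_mem_nhdsWithin] with t ht htI
  calc _ = ‖(((Y t * (Y τ)⁻¹ : Rˣ) : R) - ((X k t * (X k τ)⁻¹ : Rˣ) : R))
        + (((X k t * (X k τ)⁻¹ : Rˣ) : R) - (1 + (A t - A τ)))‖ := by congr 1; abel
    _ ≤ C ^ 4 * e k * |V t - V τ| + e k * |V t - V τ| :=
      (norm_add_le _ _).trans (add_le_add (hclose k t htI) ht)
    _ = (C ^ 4 * e k + e k) * |V t - V τ| := by ring
    _ ≤ _ := by gcongr

/-- `X` solves `dX = d[A] X` on the whole line, with control function `V`. -/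
def IsFundamentalSol (A : ℝ → R) (V : ℝ → ℝ) (X : ℝ → Rˣ) : Prop :=
  ∀ ε > 0, ∀ τ, ∀ᶠ t in 𝓝 τ,
    ‖((X t * (X τ)⁻¹ : Rˣ) : R) - (1 + (A t - A τ))‖ ≤ ε * |V t - V τ|

theorem IsRegularIntegrator.transition_eq (h : IsRegularIntegrator A V)
    (h1 : ‖(1 : R)‖ ≤ 1) {a b : ℝ} (hab : a ≤ b) {X Y : ℝ → Rˣ}
    (hX : ∀ ε > 0, IsApproxSol A V ε a b X) (hY : ∀ ε > 0, IsApproxSol A V ε a b Y)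
    {s t : ℝ} (hs : s ∈ Icc a b) (ht : t ∈ Icc a b) : Y t * (Y s)⁻¹ = X t * (X s)⁻¹ := by
  obtain ⟨ε₀, hε₀, C, hC1, hC⟩ := h.exists_transition_bound h1 hab
  refine Units.ext (sub_eq_zero.1 (norm_le_zero_iff.1 ?_))
  have key : ∀ ε > 0, ‖((Y t * (Y s)⁻¹ : Rˣ) : R) - ((X t * (X s)⁻¹ : Rˣ) : R)‖
      ≤ C ^ 4 * (ε + ε) * |V t - V s| := fun ε hε =>
    (hX ε hε).norm_transition_sub_le h.mono (hY ε hε) hab (hC X (hX _ hε₀)) (hC Y (hY _ hε₀)) hs ht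
  have hlim : Tendsto (fun ε : ℝ => C ^ 4 * (ε + ε) * |V t - V s|) (𝓝[>] 0) (𝓝 0) := by
    have : Continuous fun ε : ℝ => C ^ 4 * (ε + ε) * |V t - V s| := by fun_prop
    exact (this.tendsto' 0 0 (by simp)).mono_left nhdsWithin_le_nhds
  exact ge_of_tendsto hlim (by filter_upwards [self_mem_nhdsWithin] with ε hε using key ε hε)

theorem IsRegularIntegrator.exists_isFundamentalSol (h : IsRegularIntegrator A V)
    (h1 : ‖(1 : R)‖ ≤ 1) : ∃ X : ℝ → Rˣ, X 0 = 1 ∧ IsFundamentalSol A V X ∧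
      ∀ a b, ∃ C, ∀ s ∈ Icc a b, ∀ t ∈ Icc a b, ‖((X t * (X s)⁻¹ : Rˣ) : R)‖ ≤ C := by
  have hex : ∀ N : ℕ, ∃ X : ℝ → Rˣ, ∀ ε > 0, IsApproxSol A V ε (-(N : ℝ)) N X := fun N =>
    h.exists_sol_Icc h1 (by linarith [(Nat.cast_nonneg N : (0 : ℝ) ≤ N)])
  choose X hX using hex
  have h0 : ∀ N : ℕ, (0 : ℝ) ∈ Icc (-(N : ℝ)) N := fun N => by
    have := (Nat.cast_nonneg N : (0 : ℝ) ≤ N)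
    exact ⟨by linarith, this⟩
  -- Each `t` uses the solution on the symmetric interval of radius `⌈|t|⌉₊`; uniqueness on compact
  -- intervals makes the choice irrelevant (`hagree`).
  set Y : ℝ → Rˣ := fun t => X ⌈|t|⌉₊ t * (X ⌈|t|⌉₊ 0)⁻¹ with hY
  have hagree : ∀ (N : ℕ), ∀ t ∈ Icc (-(N : ℝ)) N, Y t = X N t * (X N 0)⁻¹ := by
    intro N t ht
    have hle : ⌈|t|⌉₊ ≤ N := Nat.ceil_le.2 (abs_le.2 ht)
    have hle' : ((⌈|t|⌉₊ : ℕ) : ℝ) ≤ N := Nat.cast_le.2 hle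
    have htM : t ∈ Icc (-((⌈|t|⌉₊ : ℕ) : ℝ)) (⌈|t|⌉₊ : ℕ) := abs_le.1 (Nat.le_ceil _)
    exact h.transition_eq h1 ((h0 _).1.trans (h0 _).2)
      (fun ε hε => (hX N ε hε).mono le_rfl (by linarith) hle') (hX _) (h0 _) htM
  have hratio : ∀ (N : ℕ), ∀ s ∈ Icc (-(N : ℝ)) N, ∀ t ∈ Icc (-(N : ℝ)) N,
      Y t * (Y s)⁻¹ = X N t * (X N s)⁻¹ := by
    intro N s hs t ht
    rw [hagree N t ht, hagree N s hs]; group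
  refine ⟨Y, by simp [hY], ?_, ?_⟩
  · intro ε hε τ
    obtain ⟨N, hN⟩ := exists_nat_gt |τ|
    have hτ : τ ∈ Ioo (-(N : ℝ)) N := abs_lt.1 hN
    have hnhds : Icc (-(N : ℝ)) N ∈ 𝓝 τ := Icc_mem_nhds hτ.1 hτ.2
    have := hX N ε hε τ (Ioo_subset_Icc_self hτ)
    rw [nhdsWithin_eq_nhds.2 hnhds] at this
    filter_upwards [this, hnhds] with t ht htI
    rwa [hratio N τ (Ioo_subset_Icc_self hτ) t htI]
  · intro a b
    obtain ⟨N, hN⟩ := exists_nat_gt (max |a| |b|)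
    have ha := abs_lt.1 ((le_max_left _ _).trans_lt hN)
    have hb := abs_lt.1 ((le_max_right _ _).trans_lt hN)
    obtain ⟨ε₀, hε₀, C, -, hC⟩ := h.exists_transition_bound h1 ((h0 N).1.trans (h0 N).2)
    have hsub : Icc a b ⊆ Icc (-(N : ℝ)) N := Icc_subset_Icc ha.1.le hb.2.le
    refine ⟨C, fun s hs t ht => ?_⟩
    rw [hratio N s (hsub hs) t (hsub ht)]
    exact hC _ (hX N ε₀ hε₀) s (hsub hs) t (hsub ht)

end NormedRing

/-! ### Fine sums and the indefinite Kurzweil–Stieltjes integral. -/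

section KurzweilStieltjes

variable {n : ℕ} {A : ℝ → ROp n} {f : ℝ → RSpace n}

/-- `Y` is the Riemann–Stieltjes sum of a `δ`-fine tagged partition of `[a, b]`. -/
def IsFineSum (A : ℝ → ROp n) (f : ℝ → RSpace n) (δ : ℝ → ℝ) (a b : ℝ) (Y : RSpace n) : Prop :=
  ∃ (m : ℕ) (α τ : ℕ → ℝ), IsFineTaggedPartition δ a b m α τ ∧
    Y = ∑ j ∈ Finset.range m, (A (α (j + 1)) - A (α j)) (f (τ j))

theorem hasKSIntegralIcc_iff {a b : ℝ} {X : RSpace n} :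
    HasKSIntegralIcc A f a b X ↔ ∀ ε > 0, ∃ δ : ℝ → ℝ, (∀ t ∈ Icc a b, 0 < δ t) ∧
      ∀ Y, IsFineSum A f δ a b Y → ‖Y - X‖ < ε := by
  constructor
  · intro h ε hε
    obtain ⟨δ, hδ, H⟩ := h ε hε
    refine ⟨δ, hδ, ?_⟩
    rintro Y ⟨m, α, τ, hp, rfl⟩
    exact H m α τ hp
  · intro h ε hε
    obtain ⟨δ, hδ, H⟩ := h ε hε
    exact ⟨δ, hδ, fun m α τ hp => H _ ⟨m, α, τ, hp, rfl⟩⟩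

theorem IsFineSum.mono {δ δ' : ℝ → ℝ} {a b : ℝ} {Y : RSpace n} (h : IsFineSum A f δ a b Y)
    (hle : ∀ t, δ t ≤ δ' t) : IsFineSum A f δ' a b Y := by
  obtain ⟨m, α, τ, ⟨h0, hm, hj⟩, rfl⟩ := h
  refine ⟨m, α, τ, ⟨h0, hm, fun j hjm => ?_⟩, rfl⟩
  obtain ⟨p, q, r⟩ := hj j hjm
  exact ⟨p, q, r.trans (Ioo_subset_Ioo (by linarith [hle (τ j)]) (by linarith [hle (τ j)]))⟩

theorem IsFineSum.add {δ : ℝ → ℝ} {a b c : ℝ} {Y Z : RSpace n} (hY : IsFineSum A f δ a b Y)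
    (hZ : IsFineSum A f δ b c Z) : IsFineSum A f δ a c (Y + Z) := by
  obtain ⟨m, α, τ, ⟨h0, hm, hj⟩, rfl⟩ := hY
  obtain ⟨m', α', τ', ⟨h0', hm', hj'⟩, rfl⟩ := hZ
  set β : ℕ → ℝ := fun j => if j ≤ m then α j else α' (j - m) with hβ
  set σ : ℕ → ℝ := fun j => if j < m then τ j else τ' (j - m) with hσ
  have β1 : ∀ j ≤ m, β j = α j := fun j hj => if_pos hj
  have β2 : ∀ j, β (m + j) = α' j := by
    intro j
    rcases Nat.eq_zero_or_pos j with rfl | hj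
    · rw [add_zero, β1 m le_rfl, hm, h0']
    · simp only [hβ]; rw [if_neg (by omega), Nat.add_sub_cancel_left]
  have σ1 : ∀ j < m, σ j = τ j := fun j hj => if_pos hj
  have σ2 : ∀ j, σ (m + j) = τ' j := fun j => by
    simp only [hσ]; rw [if_neg (by omega), Nat.add_sub_cancel_left]
  refine ⟨m + m', β, σ, ⟨by rw [β1 0 (Nat.zero_le _), h0], by rw [β2, hm'], fun j hjm => ?_⟩, ?_⟩
  · rcases lt_or_ge j m with hlt | hge
    · rw [β1 j hlt.le, β1 (j + 1) hlt, σ1 j hlt]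
      exact hj j hlt
    · obtain ⟨k, rfl⟩ := Nat.exists_eq_add_of_le hge
      rw [add_assoc, β2, β2, σ2]
      exact hj' k (by omega)
  · rw [Finset.sum_range_add]
    congr 1
    · refine Finset.sum_congr rfl fun j hj => ?_
      have hlt := Finset.mem_range.1 hj
      rw [β1 j hlt.le, β1 (j + 1) hlt, σ1 j hlt]
    · refine Finset.sum_congr rfl fun j _ => ?_
      rw [add_assoc, β2, β2, σ2]

theorem isFineSum_single {δ : ℝ → ℝ} {a b τ : ℝ} (hab : a < b) (hτ : τ ∈ Icc a b)
    (hfine : Icc a b ⊆ Ioo (τ - δ τ) (τ + δ τ)) :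
    IsFineSum A f δ a b ((A b - A a) (f τ)) := by
  refine ⟨1, fun j => if j = 0 then a else b, fun _ => τ, ⟨by simp, by simp, fun j hj => ?_⟩,
    by simp⟩
  obtain rfl : j = 0 := by omega
  simpa using ⟨hab, hτ, hfine⟩

theorem isFineSum_refl (δ : ℝ → ℝ) (a : ℝ) : IsFineSum A f δ a a 0 :=
  ⟨0, fun _ => a, fun _ => a, ⟨rfl, rfl, fun j hj => absurd hj (Nat.not_lt_zero j)⟩, by simp⟩

theorem exists_isFineSum (A : ℝ → ROp n) (f : ℝ → RSpace n) {δ : ℝ → ℝ} {a b : ℝ} (hab : a ≤ b)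
    (hδ : ∀ t ∈ Icc a b, 0 < δ t) : ∃ Y, IsFineSum A f δ a b Y := by
  refine interval_induction (P := fun x y => ∃ Y, IsFineSum A f δ x y Y) hab ?_ ?_
  · rintro x y z _ _ _ _ ⟨Y, hY⟩ ⟨Z, hZ⟩
    exact ⟨_, hY.add hZ⟩
  · intro τ hτ
    refine nhdsWithin_le_nhds ?_
    filter_upwards [Ioo_mem_nhds (show τ - δ τ < τ by linarith [hδ τ hτ])
      (show τ < τ + δ τ by linarith [hδ τ hτ])] with t ht
    refine ⟨fun h => ?_, fun h => ?_⟩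
    · rcases h.eq_or_lt with rfl | h
      · exact ⟨0, isFineSum_refl _ _⟩
      · exact ⟨_, isFineSum_single h ⟨h.le, le_rfl⟩ fun s hs =>
          ⟨ht.1.trans_le hs.1, hs.2.trans_lt (by linarith [hδ τ hτ])⟩⟩
    · rcases h.eq_or_lt with rfl | h
      · exact ⟨0, isFineSum_refl _ _⟩
      · exact ⟨_, isFineSum_single h ⟨le_rfl, h.le⟩ fun s hs =>
          ⟨(by linarith [hδ τ hτ] : τ - δ τ < τ).trans_le hs.1, hs.2.trans_lt ht.2⟩⟩

/-- If every short interval contributes nearly the increment of `G`, then a Riemann sum is near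
the increment of `G`. -/
theorem IsFineSum.norm_sub_le {δ : ℝ → ℝ} {a b c : ℝ} {Y : RSpace n} {G : ℝ → RSpace n}
    {V : ℝ → ℝ} (h : IsFineSum A f δ a b Y)
    (hG : ∀ x ∈ Icc a b, ∀ y ∈ Icc a b, ∀ τ ∈ Icc x y, Icc x y ⊆ Ioo (τ - δ τ) (τ + δ τ) →
      ‖(A y - A x) (f τ) - (G y - G x)‖ ≤ c * (V y - V x)) :
    ‖Y - (G b - G a)‖ ≤ c * (V b - V a) := by
  obtain ⟨m, α, τ, ⟨h0, hm, hj⟩, rfl⟩ := h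
  have hup : ∀ j k, j ≤ k → k ≤ m → α j ≤ α k := by
    intro j k hjk
    induction k, hjk using Nat.le_induction with
    | base => exact fun _ => le_rfl
    | succ k _ ih => exact fun hk => (ih (by omega)).trans (hj k (by omega)).1.le
  have hmem : ∀ j ≤ m, α j ∈ Icc a b := fun j hjm =>
    ⟨h0 ▸ hup 0 j (Nat.zero_le _) hjm, hm ▸ hup j m hjm le_rfl⟩
  have e1 : G b - G a = ∑ j ∈ Finset.range m, (G (α (j + 1)) - G (α j)) := by
    rw [Finset.sum_range_sub (fun j => G (α j)), h0, hm]
  have e2 : V b - V a = ∑ j ∈ Finset.range m, (V (α (j + 1)) - V (α j)) := by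
    rw [Finset.sum_range_sub (fun j => V (α j)), h0, hm]
  rw [e1, e2, ← Finset.sum_sub_distrib, Finset.mul_sum]
  refine norm_sum_le_of_le _ fun j hjm => ?_
  have hlt := Finset.mem_range.1 hjm
  exact hG _ (hmem j hlt.le) _ (hmem (j + 1) hlt) _ (hj j hlt).2.1 (hj j hlt).2.2

theorem HasKSIntegralIcc.of_isFineSum_le {a b : ℝ} {X : RSpace n} {Z : RSpace n} {M : ℝ}
    (h : HasKSIntegralIcc A f a b X) (hab : a ≤ b)
    (hb : ∀ δ Y, IsFineSum A f δ a b Y → ‖Y - Z‖ ≤ M) : ‖X - Z‖ ≤ M := by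
  refine le_of_forall_pos_lt_add fun ε hε => ?_
  obtain ⟨δ, hδ, H⟩ := hasKSIntegralIcc_iff.1 h ε hε
  obtain ⟨Y, hY⟩ := exists_isFineSum A f hab hδ
  calc ‖X - Z‖ = ‖(Y - Z) - (Y - X)‖ := by congr 1; abel
    _ ≤ ‖Y - Z‖ + ‖Y - X‖ := _root_.norm_sub_le _ _
    _ < M + ε := add_lt_add_of_le_of_lt (hb δ Y hY) (H Y hY)

/-- A function whose increments agree to first order with those of `A` times `f` is an indefinite
Kurzweil–Stieltjes integral of `f`. -/
theorem hasKSIntegralIcc_of_eventually {F : ℝ → RSpace n} {V : ℝ → ℝ} (hV : Monotone V)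
    {a b : ℝ} (hab : a ≤ b)
    (h : ∀ ε > 0, ∀ τ, ∀ᶠ t in 𝓝 τ, ‖F t - F τ - (A t - A τ) (f τ)‖ ≤ ε * |V t - V τ|) :
    HasKSIntegralIcc A f a b (F b - F a) := by
  rw [hasKSIntegralIcc_iff]
  intro ε hε
  have hV0 : 0 ≤ V b - V a := sub_nonneg.2 (hV hab)
  -- The added 1 avoids division by zero and makes the final inequality strict.
  set η := ε / (V b - V a + 1) with hη
  have hη0 : 0 < η := by positivity
  have hδ : ∀ τ, ∃ δ > 0, ∀ t, |t - τ| < δ →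
      ‖F t - F τ - (A t - A τ) (f τ)‖ ≤ η * |V t - V τ| := by
    intro τ
    obtain ⟨δ, hδ, H⟩ := Metric.eventually_nhds_iff.1 (h η hη0 τ)
    exact ⟨δ, hδ, fun t ht => H (by rwa [Real.dist_eq])⟩
  choose δ hδ H using hδ
  refine ⟨δ, fun t _ => hδ t, fun Y hY => ?_⟩
  have hle : ‖Y - (F b - F a)‖ ≤ η * (V b - V a) := by
    refine hY.norm_sub_le fun x _ y _ τ hτ hfine => ?_
    have hx := hfine (left_mem_Icc.2 (hτ.1.trans hτ.2))
    have hy := hfine (right_mem_Icc.2 (hτ.1.trans hτ.2))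
    have Hx := H τ x (abs_lt.2 ⟨by linarith [hx.1], by linarith [hx.2]⟩)
    have Hy := H τ y (abs_lt.2 ⟨by linarith [hy.1], by linarith [hy.2]⟩)
    rw [abs_sub_comm, abs_of_nonneg (sub_nonneg.2 (hV hτ.1))] at Hx
    rw [abs_of_nonneg (sub_nonneg.2 (hV hτ.2))] at Hy
    calc ‖(A y - A x) (f τ) - (F y - F x)‖
        = ‖(F x - F τ - (A x - A τ) (f τ)) - (F y - F τ - (A y - A τ) (f τ))‖ := by
          congr 1; simp only [sub_apply]; abel
      _ ≤ η * (V y - V x) := (_root_.norm_sub_le _ _).trans (by linarith)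
  refine hle.trans_lt ?_
  rw [hη, div_mul_eq_mul_div, div_lt_iff₀ (by positivity)]
  nlinarith

/-- Prefixing a fine sum on `[c, d]` with a sum on `[a, c]` that is fine for both gauges gives a
fine sum on `[a, d]`. Subtracting the two known approximations leaves the one wanted. -/
theorem HasKSIntegralIcc.sub_left {F : ℝ → RSpace n} {a c d : ℝ} (hac : a ≤ c) (hcd : c ≤ d)
    (h1 : HasKSIntegralIcc A f a c (F c - F a)) (h2 : HasKSIntegralIcc A f a d (F d - F a)) :
    HasKSIntegralIcc A f c d (F d - F c) := by
  rw [hasKSIntegralIcc_iff] at *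
  intro ε hε
  obtain ⟨δ, hδ, H⟩ := h2 (ε / 2) (half_pos hε)
  obtain ⟨δ', hδ', H'⟩ := h1 (ε / 2) (half_pos hε)
  refine ⟨δ, fun t ht => hδ t ⟨hac.trans ht.1, ht.2⟩, fun Y hY => ?_⟩
  obtain ⟨Z, hZ⟩ := exists_isFineSum A f (δ := fun t => min (δ t) (δ' t)) hac
    fun t ht => lt_min (hδ t ⟨ht.1, ht.2.trans hcd⟩) (hδ' t ht)
  have b1 := H' Z (hZ.mono fun t => min_le_right _ _)
  have b2 := H _ ((hZ.mono fun t => min_le_left _ _).add hY)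
  calc ‖Y - (F d - F c)‖ = ‖(Z + Y - (F d - F a)) - (Z - (F c - F a))‖ := by congr 1; abel
    _ ≤ _ := _root_.norm_sub_le _ _
    _ < ε := by linarith

theorem HasKSIntegralIcc.sub_right {F : ℝ → RSpace n} {c d b : ℝ} (hcd : c ≤ d) (hdb : d ≤ b)
    (h1 : HasKSIntegralIcc A f d b (F b - F d)) (h2 : HasKSIntegralIcc A f c b (F b - F c)) :
    HasKSIntegralIcc A f c d (F d - F c) := by
  rw [hasKSIntegralIcc_iff] at *
  intro ε hε
  obtain ⟨δ, hδ, H⟩ := h2 (ε / 2) (half_pos hε)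
  obtain ⟨δ', hδ', H'⟩ := h1 (ε / 2) (half_pos hε)
  refine ⟨δ, fun t ht => hδ t ⟨ht.1, ht.2.trans hdb⟩, fun Y hY => ?_⟩
  obtain ⟨Z, hZ⟩ := exists_isFineSum A f (δ := fun t => min (δ t) (δ' t)) hdb
    fun t ht => lt_min (hδ t ⟨hcd.trans ht.1, ht.2⟩) (hδ' t ht)
  have b1 := H' Z (hZ.mono fun t => min_le_right _ _)
  have b2 := H _ (hY.add (hZ.mono fun t => min_le_left _ _))
  calc ‖Y - (F d - F c)‖ = ‖(Y + Z - (F b - F c)) - (Z - (F b - F d))‖ := by congr 1; abel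
    _ ≤ _ := _root_.norm_sub_le _ _
    _ < ε := by linarith

/-- The indefinite integral has right jumps `Δ⁺A f`. -/
theorem eventually_norm_sub_le_right {F : ℝ → RSpace n} {τ b : ℝ} (hτb : τ < b)
    (h : ∀ c ∈ Icc τ b, HasKSIntegralIcc A f c b (F b - F c)) {ε : ℝ} (hε : 0 < ε) :
    ∀ᶠ t in 𝓝[>] τ, ‖F t - F τ - (A t - A τ) (f τ)‖ ≤ ε := by
  obtain ⟨δ, hδ, H⟩ := hasKSIntegralIcc_iff.1 (h τ ⟨le_rfl, hτb.le⟩) (ε / 2) (half_pos hε)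
  have hδτ := hδ τ ⟨le_rfl, hτb.le⟩
  filter_upwards [Ioo_mem_nhdsGT (lt_min hτb (show τ < τ + δ τ by linarith))] with t ht
  have htb := ht.2.trans_le (min_le_left _ _)
  have htδ := ht.2.trans_le (min_le_right _ _)
  obtain ⟨δ', hδ', H'⟩ := hasKSIntegralIcc_iff.1 (h t ⟨ht.1.le, htb.le⟩) (ε / 2) (half_pos hε)
  obtain ⟨Z, hZ⟩ := exists_isFineSum A f (δ := fun t => min (δ t) (δ' t)) htb.le
    fun s hs => lt_min (hδ s ⟨ht.1.le.trans hs.1, hs.2⟩) (hδ' s hs)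
  have b1 := H' Z (hZ.mono fun t => min_le_right _ _)
  -- The interval `[τ, t]` tagged at `τ` contributes exactly `(A t - A τ) (f τ)`; the rest of the
  -- sum approximates `F b - F t`.
  have b2 := H _ ((isFineSum_single ht.1 ⟨le_rfl, ht.1.le⟩ fun s hs =>
    ⟨(by linarith : τ - δ τ < τ).trans_le hs.1, hs.2.trans_lt htδ⟩).add
      (hZ.mono fun t => min_le_left _ _))
  calc _ = ‖(Z - (F b - F t)) - ((A t - A τ) (f τ) + Z - (F b - F τ))‖ := by congr 1; abel
    _ ≤ _ := _root_.norm_sub_le _ _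
    _ ≤ ε := by linarith

/-- The indefinite integral has left jumps `Δ⁻A f`. -/
theorem eventually_norm_sub_le_left {F : ℝ → RSpace n} {a τ : ℝ} (haτ : a < τ)
    (h : ∀ c ∈ Icc a τ, HasKSIntegralIcc A f a c (F c - F a)) {ε : ℝ} (hε : 0 < ε) :
    ∀ᶠ t in 𝓝[<] τ, ‖F t - F τ - (A t - A τ) (f τ)‖ ≤ ε := by
  obtain ⟨δ, hδ, H⟩ := hasKSIntegralIcc_iff.1 (h τ ⟨haτ.le, le_rfl⟩) (ε / 2) (half_pos hε)
  have hδτ := hδ τ ⟨haτ.le, le_rfl⟩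
  filter_upwards [Ioo_mem_nhdsLT (max_lt haτ (show τ - δ τ < τ by linarith))] with t ht
  have hat := (le_max_left _ _).trans_lt ht.1
  have htδ := (le_max_right _ _).trans_lt ht.1
  obtain ⟨δ', hδ', H'⟩ := hasKSIntegralIcc_iff.1 (h t ⟨hat.le, ht.2.le⟩) (ε / 2) (half_pos hε)
  obtain ⟨Z, hZ⟩ := exists_isFineSum A f (δ := fun t => min (δ t) (δ' t)) hat.le
    fun s hs => lt_min (hδ s ⟨hs.1, hs.2.trans ht.2.le⟩) (hδ' s hs)
  have b1 := H' Z (hZ.mono fun t => min_le_right _ _)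
  have b2 := H _ ((hZ.mono fun t => min_le_left _ _).add
    (isFineSum_single ht.2 ⟨ht.2.le, le_rfl⟩ fun s hs =>
      ⟨htδ.trans_le hs.1, hs.2.trans_lt (by linarith : τ < τ + δ τ)⟩))
  calc _ = ‖(Z + (A τ - A t) (f τ) - (F τ - F a)) - (Z - (F t - F a))‖ := by
        congr 1; simp only [sub_apply]; abel
    _ ≤ _ := _root_.norm_sub_le _ _
    _ ≤ ε := by linarith

end KurzweilStieltjes

/-! ### From the integral equation to the first-order condition, and uniqueness. -/

section KurzweilStieltjes

variable {n : ℕ} {A : ℝ → ROp n} {V : ℝ → ℝ} {z : ℝ → RSpace n}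

/-- `z` is, on `[a, b]`, an indefinite integral of itself with respect to `A`. -/
def IsKSSolOn (A : ℝ → ROp n) (z : ℝ → RSpace n) (a b : ℝ) : Prop :=
  ∀ c d, a ≤ c → c ≤ d → d ≤ b → HasKSIntegralIcc A z c d (z d - z c)

theorem IsKSSolOn.mono {a b a' b' : ℝ} (h : IsKSSolOn A z a b) (ha : a ≤ a') (hb : b' ≤ b) :
    IsKSSolOn A z a' b' := fun c d hc hcd hd => h c d (ha.trans hc) hcd (hd.trans hb)

/-- No boundedness of `z` is presupposed: the jump formula with error 1 bounds `z` on both sides of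
each point, and Cousin's lemma combines the local bounds. -/
theorem IsKSSolOn.exists_bound (hV : Monotone V) (hA : ∀ s t, ‖A t - A s‖ ≤ |V t - V s|)
    {a b : ℝ} (hab : a ≤ b) (h : IsKSSolOn A z a b) : ∃ M, ∀ t ∈ Icc a b, ‖z t‖ ≤ M := by
  refine interval_induction (P := fun x y => ∃ M, ∀ t ∈ Icc x y, ‖z t‖ ≤ M) hab ?_ ?_
  · rintro x y w _ _ _ _ ⟨M, hM⟩ ⟨M', hM'⟩
    refine ⟨max M M', fun t ht => ?_⟩
    rcases le_total t y with hty | hty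
    · exact (hM t ⟨ht.1, hty⟩).trans (le_max_left _ _)
    · exact (hM' t ⟨hty, ht.2⟩).trans (le_max_right _ _)
  · intro τ hτ
    set M := 1 + ‖z τ‖ + (V b - V a) * ‖z τ‖ with hM
    have hVab : 0 ≤ V b - V a := sub_nonneg.2 (hV hab)
    have hzτ : ‖z τ‖ ≤ M := by nlinarith [norm_nonneg (z τ)]
    have step : ∀ t ∈ Icc a b, ‖z t - z τ - (A t - A τ) (z τ)‖ ≤ 1 → ‖z t‖ ≤ M := by
      intro t ht h1
      have hAt : ‖A t - A τ‖ ≤ V b - V a := by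
        refine (hA τ t).trans (abs_le.2 ⟨?_, ?_⟩) <;>
        linarith [hV hτ.1, hV hτ.2, hV ht.1, hV ht.2]
      calc ‖z t‖ = ‖(z t - z τ - (A t - A τ) (z τ)) + z τ + (A t - A τ) (z τ)‖ := by
            congr 1; abel
        _ ≤ ‖z t - z τ - (A t - A τ) (z τ)‖ + ‖z τ‖ + ‖(A t - A τ) (z τ)‖ := norm_add₃_le
        _ ≤ M := by
          have := (A t - A τ).le_of_opNorm_le hAt (z τ)
          linarith
    have hR : ∀ᶠ t in 𝓝[>] τ, t ∈ Icc a b → ∃ M, ∀ s ∈ Icc τ t, ‖z s‖ ≤ M := by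
      rcases hτ.2.eq_or_lt with rfl | hlt
      · filter_upwards [self_mem_nhdsWithin] with t ht htI
        exact absurd htI.2 (not_le.2 ht)
      · have := eventually_norm_sub_le_right hlt
          (fun c hc => h c b (hτ.1.trans hc.1) hc.2 le_rfl) one_pos
        obtain ⟨β, hβ, hβJ⟩ := (mem_nhdsGT_iff_exists_Ioo_subset).1 this
        filter_upwards [Ioo_mem_nhdsGT hβ] with t ht htI
        refine ⟨M, fun s hs => ?_⟩
        rcases hs.1.eq_or_lt with rfl | hs'
        · exact hzτ
        · exact step s ⟨hτ.1.trans hs.1, hs.2.trans htI.2⟩ (hβJ ⟨hs', hs.2.trans_lt ht.2⟩)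
    have hL : ∀ᶠ t in 𝓝[<] τ, t ∈ Icc a b → ∃ M, ∀ s ∈ Icc t τ, ‖z s‖ ≤ M := by
      rcases hτ.1.eq_or_lt with rfl | hlt
      · filter_upwards [self_mem_nhdsWithin] with t ht htI
        exact absurd htI.1 (not_le.2 ht)
      · have := eventually_norm_sub_le_left hlt
          (fun c hc => h a c le_rfl hc.1 (hc.2.trans hτ.2)) one_pos
        obtain ⟨β, hβ, hβJ⟩ := (mem_nhdsLT_iff_exists_Ioo_subset).1 this
        filter_upwards [Ioo_mem_nhdsLT hβ] with t ht htI
        refine ⟨M, fun s hs => ?_⟩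
        rcases hs.2.eq_or_lt with rfl | hs'
        · exact hzτ
        · exact step s ⟨htI.1.trans hs.1, hs.2.trans hτ.2⟩ (hβJ ⟨ht.1.trans_le hs.1, hs'⟩)
    have hself : ∃ M, ∀ s ∈ Icc τ τ, ‖z s‖ ≤ M :=
      ⟨‖z τ‖, fun s hs => by rw [Icc_self, mem_singleton_iff] at hs; rw [hs]⟩
    refine eventually_nhdsWithin_iff.2 ?_
    filter_upwards [eventually_nhdsWithin_iff.1 hR, eventually_nhdsWithin_iff.1 hL] with t hr hl htI
    refine ⟨fun ht => ?_, fun ht => ?_⟩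
    · rcases ht.eq_or_lt with rfl | ht
      exacts [hself, hl ht htI]
    · rcases ht.eq_or_lt with rfl | ht
      exacts [hself, hr ht htI]

theorem IsKSSolOn.norm_sub_sub_le (hV : Monotone V) (hA : ∀ s t, ‖A t - A s‖ ≤ |V t - V s|)
    {a b M : ℝ} (hab : a ≤ b) (h : IsKSSolOn A z a b) (p : RSpace n)
    (hM : ∀ t ∈ Icc a b, ‖z t - p‖ ≤ M) :
    ‖z b - z a - (A b - A a) p‖ ≤ M * (V b - V a) := by
  refine (h a b le_rfl hab le_rfl).of_isFineSum_le hab fun δ Y hY => ?_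
  have := hY.norm_sub_le (G := fun t => A t p) (V := V) (c := M) (by
    intro x hx y hy τ hτ _
    have e : (A y - A x) (z τ) - (A y p - A x p) = (A y - A x) (z τ - p) := by
      simp only [map_sub, sub_apply]
    rw [e, mul_comm]
    have hA' := hA x y
    rw [abs_of_nonneg (sub_nonneg.2 (hV (hτ.1.trans hτ.2)))] at hA'
    exact ((A y - A x).le_opNorm _).trans (mul_le_mul hA' (hM τ ⟨hx.1.trans hτ.1, hτ.2.trans hy.2⟩)
      (norm_nonneg _) ((norm_nonneg _).trans hA')))
  simpa only [sub_apply] using this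

theorem IsKSSolOn.norm_sub_le (hV : Monotone V) (hA : ∀ s t, ‖A t - A s‖ ≤ |V t - V s|)
    {a b M : ℝ} (h : IsKSSolOn A z a b) (hM : ∀ t ∈ Icc a b, ‖z t‖ ≤ M)
    {c d : ℝ} (hc : a ≤ c) (hcd : c ≤ d) (hd : d ≤ b) : ‖z d - z c‖ ≤ M * (V d - V c) := by
  simpa using (h.mono hc hd).norm_sub_sub_le hV hA hcd 0
    (fun t ht => by simpa using hM t ⟨hc.trans ht.1, ht.2.trans hd⟩)

/-- The jump formula gives an error tending to 0, but one that is small relative to `V t - V τ` is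
needed. Splitting at `γ` in `(τ, t)`, the jump formula costs an arbitrary `η` on `[τ, γ]`. On `[γ,
t]` the integrand differs from `z τ` by at most `M * (V t - V τ)`, and the further factor `V t - V
γ` is small because the jump of `V` at `τ` has been passed. -/
theorem IsKSSolOn.eventually_right (hV : Monotone V) (hA : ∀ s t, ‖A t - A s‖ ≤ |V t - V s|)
    {τ b : ℝ} (hτb : τ < b) (h : IsKSSolOn A z τ b) {ε : ℝ} (hε : 0 < ε) :
    ∀ᶠ t in 𝓝[>] τ, ‖z t - z τ - (A t - A τ) (z τ)‖ ≤ ε * |V t - V τ| := by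
  obtain ⟨M, hM⟩ := h.exists_bound hV hA hτb.le
  have hM0 : 0 ≤ M := (norm_nonneg _).trans (hM τ ⟨le_rfl, hτb.le⟩)
  obtain ⟨v, hv⟩ : ∃ v, Tendsto V (𝓝[>] τ) (𝓝 v) := ⟨_, hV.tendsto_nhdsGT τ⟩
  have hsmall : ∀ᶠ t in 𝓝[>] τ, M * (V t - v) < ε :=
    ((hv.sub_const v).const_mul M).eventually_lt_const (by simpa using hε)
  filter_upwards [hsmall, Ioo_mem_nhdsGT hτb] with t ht htI
  have hVt : 0 ≤ V t - V τ := sub_nonneg.2 (hV htI.1.le)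
  rw [abs_of_nonneg hVt]
  refine le_of_forall_pos_le_add fun η hη => ?_
  have hj := eventually_norm_sub_le_right hτb (fun c hc => h c b hc.1 hc.2 le_rfl) hη
  obtain ⟨γ, hγ, hγI⟩ := (hj.and (Ioo_mem_nhdsGT htI.1)).exists
  have hvγ : v ≤ V γ := le_of_tendsto hv (by
    filter_upwards [Ioo_mem_nhdsGT hγI.1] with s hs using hV hs.2.le)
  have key := (h.mono hγI.1.le htI.2.le).norm_sub_sub_le hV hA hγI.2.le (z τ)
    (M := M * (V t - V τ)) (fun s hs =>
      (h.norm_sub_le hV hA hM le_rfl (hγI.1.le.trans hs.1) (hs.2.trans htI.2.le)).trans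
        (mul_le_mul_of_nonneg_left (by linarith [hV hs.2]) hM0))
  have key' : M * (V t - V τ) * (V t - V γ) ≤ ε * (V t - V τ) := by
    have : M * (V t - V γ) ≤ ε :=
      (mul_le_mul_of_nonneg_left (by linarith) hM0).trans ht.le
    calc _ = M * (V t - V γ) * (V t - V τ) := by ring
      _ ≤ _ := mul_le_mul_of_nonneg_right this hVt
  calc _ = ‖(z t - z γ - (A t - A γ) (z τ)) + (z γ - z τ - (A γ - A τ) (z τ))‖ := by
        congr 1; simp only [sub_apply]; abel
    _ ≤ _ := (norm_add_le _ _).trans (add_le_add (key.trans key') hγ)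

theorem IsKSSolOn.eventually_left (hV : Monotone V) (hA : ∀ s t, ‖A t - A s‖ ≤ |V t - V s|)
    {a τ : ℝ} (haτ : a < τ) (h : IsKSSolOn A z a τ) {ε : ℝ} (hε : 0 < ε) :
    ∀ᶠ t in 𝓝[<] τ, ‖z t - z τ - (A t - A τ) (z τ)‖ ≤ ε * |V t - V τ| := by
  obtain ⟨M, hM⟩ := h.exists_bound hV hA haτ.le
  have hM0 : 0 ≤ M := (norm_nonneg _).trans (hM τ ⟨haτ.le, le_rfl⟩)
  obtain ⟨v, hv⟩ : ∃ v, Tendsto V (𝓝[<] τ) (𝓝 v) := ⟨_, hV.tendsto_nhdsLT τ⟩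
  have hsmall : ∀ᶠ t in 𝓝[<] τ, M * (v - V t) < ε :=
    ((tendsto_const_nhds.sub hv).const_mul M).eventually_lt_const (by simpa using hε)
  filter_upwards [hsmall, Ioo_mem_nhdsLT haτ] with t ht htI
  have hVt : 0 ≤ V τ - V t := sub_nonneg.2 (hV htI.2.le)
  rw [abs_sub_comm, abs_of_nonneg hVt]
  refine le_of_forall_pos_le_add fun η hη => ?_
  have hj := eventually_norm_sub_le_left haτ (fun c hc => h a c le_rfl hc.1 hc.2) hη
  obtain ⟨γ, hγ, hγI⟩ := (hj.and (Ioo_mem_nhdsLT htI.2)).exists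
  have hvγ : V γ ≤ v := ge_of_tendsto hv (by
    filter_upwards [Ioo_mem_nhdsLT hγI.2] with s hs using hV hs.1.le)
  have key := (h.mono htI.1.le hγI.2.le).norm_sub_sub_le hV hA hγI.1.le (z τ)
    (M := M * (V τ - V t)) (fun s hs => by
      rw [norm_sub_rev]
      exact (h.norm_sub_le hV hA hM (htI.1.le.trans hs.1) (hs.2.trans hγI.2.le) le_rfl).trans
        (mul_le_mul_of_nonneg_left (by linarith [hV hs.1]) hM0))
  have key' : M * (V τ - V t) * (V γ - V t) ≤ ε * (V τ - V t) := by
    have : M * (V γ - V t) ≤ ε :=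
      (mul_le_mul_of_nonneg_left (by linarith) hM0).trans ht.le
    calc _ = M * (V γ - V t) * (V τ - V t) := by ring
      _ ≤ _ := mul_le_mul_of_nonneg_right this hVt
  calc _ = ‖(z γ - z τ - (A γ - A τ) (z τ)) - (z γ - z t - (A γ - A t) (z τ))‖ := by
        congr 1; simp only [sub_apply]; abel
    _ ≤ _ := (_root_.norm_sub_le _ _).trans (by linarith)

/-- A solution of the integral equation satisfies it to first order at every point. -/
theorem eventually_of_hasKSIntegral (hV : Monotone V) (hA : ∀ s t, ‖A t - A s‖ ≤ |V t - V s|)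
    {s : ℝ} (h : ∀ t, HasKSIntegral A z s t (z t - z s)) {ε : ℝ} (hε : 0 < ε) (τ : ℝ) :
    ∀ᶠ t in 𝓝 τ, ‖z t - z τ - (A t - A τ) (z τ)‖ ≤ ε * |V t - V τ| := by
  have hup : ∀ t, s ≤ t → HasKSIntegralIcc A z s t (z t - z s) := fun t ht => by
    have := h t; rwa [HasKSIntegral, if_pos ht] at this
  have hdown : ∀ t, t ≤ s → HasKSIntegralIcc A z t s (z s - z t) := fun t ht => by
    rcases ht.eq_or_lt with rfl | ht
    · exact hup t le_rfl
    · have := h t; rwa [HasKSIntegral, if_neg (not_le.2 ht), neg_sub] at this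
  have hR : ∀ b, IsKSSolOn A z s b := fun b c d hc hcd _ =>
    (hup c hc).sub_left hc hcd (hup d (hc.trans hcd))
  have hL : ∀ a, IsKSSolOn A z a s := fun a c d _ hcd hd =>
    (hdown d hd).sub_right hcd hd (hdown c (hcd.trans hd))
  have e1 : ∀ᶠ t in 𝓝[>] τ, ‖z t - z τ - (A t - A τ) (z τ)‖ ≤ ε * |V t - V τ| := by
    rcases lt_or_ge τ s with hlt | hge
    · exact (hL τ).eventually_right hV hA hlt hε
    · exact ((hR (τ + 1)).mono hge le_rfl).eventually_right hV hA (lt_add_one τ) hε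
  have e2 : ∀ᶠ t in 𝓝[<] τ, ‖z t - z τ - (A t - A τ) (z τ)‖ ≤ ε * |V t - V τ| := by
    rcases lt_or_ge s τ with hlt | hge
    · exact (hR τ).eventually_left hV hA hlt hε
    · exact ((hL (τ - 1)).mono le_rfl hge).eventually_left hV hA (sub_one_lt τ) hε
  filter_upwards [eventually_nhdsWithin_iff.1 e1, eventually_nhdsWithin_iff.1 e2] with t h1 h2
  rcases lt_trichotomy t τ with ht | rfl | ht
  · exact h2 ht
  · simp
  · exact h1 ht

/-- Uniqueness: a first-order solution is transported by any fundamental solution. -/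
theorem IsFundamentalSol.eq_of_eventually {V' : ℝ → ℝ} (hV : Monotone V) (hV' : Monotone V')
    {X : ℝ → (ROp n)ˣ} (hX : IsFundamentalSol A V X)
    (hC : ∀ a b, ∃ C, ∀ s ∈ Icc a b, ∀ t ∈ Icc a b, ‖((X t * (X s)⁻¹ : (ROp n)ˣ) : ROp n)‖ ≤ C)
    (hz : ∀ ε > 0, ∀ τ, ∀ᶠ t in 𝓝 τ, ‖z t - z τ - (A t - A τ) (z τ)‖ ≤ ε * |V' t - V' τ|)
    (s t : ℝ) : z t = ((X t * (X s)⁻¹ : (ROp n)ˣ) : ROp n) (z s) := by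
  set a := min s t
  set b := max s t
  have hs : s ∈ Icc a b := ⟨min_le_left _ _, le_max_left _ _⟩
  have ht : t ∈ Icc a b := ⟨min_le_right _ _, le_max_right _ _⟩
  obtain ⟨C, hC⟩ := hC a b
  -- `X` and `z` may have different control functions, as happens for the translate by a period; `W`
  -- dominates the increments of both.
  set W : ℝ → ℝ := fun t => V t + V' t with hW
  have hWm : Monotone W := hV.add hV'
  have hW1 : ∀ p q, |V p - V q| ≤ |W p - W q| ∧ |V' p - V' q| ≤ |W p - W q| := by
    intro p q
    rcases le_total p q with hpq | hpq
    · rw [abs_sub_comm (V p), abs_sub_comm (V' p), abs_sub_comm (W p),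
        abs_of_nonneg (sub_nonneg.2 (hV hpq)), abs_of_nonneg (sub_nonneg.2 (hV' hpq)),
        abs_of_nonneg (sub_nonneg.2 (hWm hpq))]
      constructor <;> linarith [hV hpq, hV' hpq]
    · rw [abs_of_nonneg (sub_nonneg.2 (hV hpq)), abs_of_nonneg (sub_nonneg.2 (hV' hpq)),
        abs_of_nonneg (sub_nonneg.2 (hWm hpq))]
      constructor <;> linarith [hV hpq, hV' hpq]
  -- `z` pulled back to time `s`. Its increments are `o(|W r - W τ|)` at every `τ`, so it is
  -- constant.
  set y : ℝ → RSpace n := fun r => ((X s * (X r)⁻¹ : (ROp n)ˣ) : ROp n) (z r) with hy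
  have key : ∀ K > 0, ‖y t - y s‖ ≤ K * |W t - W s| := by
    intro K hK
    refine norm_sub_le_of_eventually hWm (a := a) (b := b) (fun τ hτ => ?_) s hs t ht
    set D := (|C| + 1) * (1 + ‖z τ‖) with hD
    have hD0 : 0 < D := by positivity
    filter_upwards [nhdsWithin_le_nhds (hX (K / D) (by positivity) τ),
      nhdsWithin_le_nhds (hz (K / D) (by positivity) τ), self_mem_nhdsWithin] with r h1 h2 hr
    have e : y r - y τ = ((X s * (X r)⁻¹ : (ROp n)ˣ) : ROp n)
        ((z r - z τ - (A r - A τ) (z τ))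
          - (((X r * (X τ)⁻¹ : (ROp n)ˣ) : ROp n) - (1 + (A r - A τ))) (z τ)) := by
      have e1 : ((X s * (X τ)⁻¹ : (ROp n)ˣ) : ROp n)
          = ((X s * (X r)⁻¹ : (ROp n)ˣ) : ROp n) * ((X r * (X τ)⁻¹ : (ROp n)ˣ) : ROp n) := by
        rw [← Units.val_mul]; congr 1; group
      simp only [hy]
      rw [e1, mul_apply_eq_comp, ← map_sub]
      congr 1
      simp only [sub_apply, add_apply, one_apply_eq_self]
      abel
    rw [e]
    have hCr : ‖((X s * (X r)⁻¹ : (ROp n)ˣ) : ROp n)‖ ≤ |C| + 1 :=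
      (hC r hr s hs).trans ((le_abs_self C).trans (by linarith))
    have b1 : ‖(((X r * (X τ)⁻¹ : (ROp n)ˣ) : ROp n) - (1 + (A r - A τ))) (z τ)‖
        ≤ K / D * |W r - W τ| * ‖z τ‖ :=
      ContinuousLinearMap.le_of_opNorm_le _ (h1.trans (mul_le_mul_of_nonneg_left (hW1 r τ).1 (by positivity))) _
    have b2 : ‖z r - z τ - (A r - A τ) (z τ)‖ ≤ K / D * |W r - W τ| :=
      h2.trans (mul_le_mul_of_nonneg_left (hW1 r τ).2 (by positivity))
    refine (ContinuousLinearMap.le_of_opNorm_le _ hCr _).trans ?_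
    calc _ ≤ (|C| + 1) * (K / D * |W r - W τ| + K / D * |W r - W τ| * ‖z τ‖) := by
          gcongr; exact (_root_.norm_sub_le _ _).trans (add_le_add b2 b1)
      _ = K / D * D * |W r - W τ| := by rw [hD]; ring
      _ = K * |W r - W τ| := by rw [div_mul_cancel₀ _ hD0.ne']
  have hzero : ‖y t - y s‖ ≤ 0 := by
    have hlim : Tendsto (fun K : ℝ => K * |W t - W s|) (𝓝[>] 0) (𝓝 0) := by
      have : Continuous fun K : ℝ => K * |W t - W s| := by fun_prop
      exact (this.tendsto' 0 0 (by simp)).mono_left nhdsWithin_le_nhds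
    exact ge_of_tendsto hlim (by filter_upwards [self_mem_nhdsWithin] with K hK using key K hK)
  have heq : y t = y s := sub_eq_zero.1 (norm_le_zero_iff.1 hzero)
  have hys : y s = z s := by simp only [hy, mul_inv_cancel, Units.val_one, one_apply_eq_self]
  rw [← hys, ← heq]
  simp only [hy]
  rw [← mul_apply_eq_comp, ← Units.val_mul]
  have : X t * (X s)⁻¹ * (X s * (X t)⁻¹) = 1 := by group
  rw [this]; simp

/-- The columns of a fundamental solution solve the equation to first order. -/
theorem IsFundamentalSol.eventually_apply {X : ℝ → (ROp n)ˣ} (hX : IsFundamentalSol A V X)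
    (s : ℝ) (v : RSpace n) {ε : ℝ} (hε : 0 < ε) (τ : ℝ) : ∀ᶠ t in 𝓝 τ,
      ‖((X t * (X s)⁻¹ : (ROp n)ˣ) : ROp n) v - ((X τ * (X s)⁻¹ : (ROp n)ˣ) : ROp n) v
        - (A t - A τ) (((X τ * (X s)⁻¹ : (ROp n)ˣ) : ROp n) v)‖ ≤ ε * |V t - V τ| := by
  set w := ((X τ * (X s)⁻¹ : (ROp n)ˣ) : ROp n) v with hw
  filter_upwards [hX (ε / (‖w‖ + 1)) (by positivity) τ] with t ht
  have e : ((X t * (X s)⁻¹ : (ROp n)ˣ) : ROp n) v = ((X t * (X τ)⁻¹ : (ROp n)ˣ) : ROp n) w := by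
    rw [hw, ← mul_apply_eq_comp, ← Units.val_mul]
    congr 2; group
  have e' : ((X t * (X s)⁻¹ : (ROp n)ˣ) : ROp n) v - w - (A t - A τ) w
      = (((X t * (X τ)⁻¹ : (ROp n)ˣ) : ROp n) - (1 + (A t - A τ))) w := by
    rw [e]; simp only [sub_apply, add_apply, one_apply_eq_self]; abel
  rw [e']
  calc _ ≤ ε / (‖w‖ + 1) * |V t - V τ| * ‖w‖ := ContinuousLinearMap.le_of_opNorm_le _ ht _
    _ ≤ ε / (‖w‖ + 1) * |V t - V τ| * (‖w‖ + 1) := by gcongr; linarith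
    _ = ε * |V t - V τ| := by field_simp

theorem IsFundamentalSol.isTransitionMatrix (hV : Monotone V) {X : ℝ → (ROp n)ˣ}
    (hX : IsFundamentalSol A V X) :
    IsTransitionMatrix A fun t s => ((X t * (X s)⁻¹ : (ROp n)ˣ) : ROp n) := by
  intro t s v
  set F : ℝ → RSpace n := fun r => ((X r * (X s)⁻¹ : (ROp n)ˣ) : ROp n) v with hF
  have hFs : F s = v := by simp only [hF, mul_inv_cancel, Units.val_one, one_apply_eq_self]
  have key : ∀ {a b : ℝ}, a ≤ b → HasKSIntegralIcc A F a b (F b - F a) := fun hab =>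
    hasKSIntegralIcc_of_eventually hV hab fun ε hε τ => hX.eventually_apply s v hε τ
  change HasKSIntegral A F s t (F t - v)
  rw [HasKSIntegral, ← hFs]
  split_ifs with hst
  · exact key hst
  · rw [neg_sub]; exact key (not_le.1 hst).le

/-- Every fine sum over a degenerate interval is zero, so the integral from `s` to `s` vanishes. -/
theorem IsTransitionMatrix.self {U : ℝ → ℝ → ROp n} (hU : IsTransitionMatrix A U) (s : ℝ) :
    U s s = 1 := by
  ext1 v
  have h := hU s s v
  rw [HasKSIntegral, if_pos le_rfl] at h
  have h0 := h.of_isFineSum_le (Z := 0) (M := 0) le_rfl (by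
    rintro δ Y hY
    have := hY.norm_sub_le (G := fun _ => 0) (V := fun _ => (0 : ℝ)) (c := 0) (by
      intro x hx y hy τ _ _
      obtain rfl : x = y := by rw [Icc_self] at hx hy; exact hx.trans hy.symm
      simp)
    simpa using this)
  simpa [sub_eq_zero] using h0

theorem IsTransitionMatrix.eq (hV : Monotone V) (hA : ∀ s t, ‖A t - A s‖ ≤ |V t - V s|)
    {X : ℝ → (ROp n)ˣ} (hX : IsFundamentalSol A V X)
    (hC : ∀ a b, ∃ C, ∀ s ∈ Icc a b, ∀ t ∈ Icc a b, ‖((X t * (X s)⁻¹ : (ROp n)ˣ) : ROp n)‖ ≤ C)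
    {U : ℝ → ℝ → ROp n} (hU : IsTransitionMatrix A U) :
    U = fun t s => ((X t * (X s)⁻¹ : (ROp n)ˣ) : ROp n) := by
  funext t s
  ext1 v
  have hs : U s s v = v := by rw [hU.self]; rfl
  have hks : ∀ t, HasKSIntegral A (fun r => U r s v) s t (U t s v - U s s v) := fun t => by
    rw [hs]; exact hU t s v
  have := hX.eq_of_eventually hV hV hC (z := fun r => U r s v)
    (fun ε hε τ => eventually_of_hasKSIntegral hV hA hks hε τ) s t
  rwa [hs] at this

end KurzweilStieltjes

/-! ### Bounded variation as a control function, and Floquet's relation. -/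

section Floquet

variable {n : ℕ} {A : ℝ → ROp n} {V : ℝ → ℝ}

theorem LocallyBoundedVariationOn.isRegularIntegrator
    (hA : LocallyBoundedVariationOn A univ) (hH : ConditionH A) :
    IsRegularIntegrator A (variationOnFromTo A univ 0) := by
  have hmono : Monotone (variationOnFromTo A univ 0) :=
    monotoneOn_univ.1 (variationOnFromTo.monotoneOn hA (mem_univ _))
  have hle : ∀ s t, s ≤ t →
      ‖A t - A s‖ ≤ variationOnFromTo A univ 0 t - variationOnFromTo A univ 0 s := by
    intro s t hst
    rw [variationOnFromTo.sub_right hA (mem_univ _) (mem_univ _) (mem_univ _),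
      variationOnFromTo.eq_of_le A univ hst, ← dist_eq_norm, dist_edist]
    exact ENNReal.toReal_mono (hA s t (mem_univ _) (mem_univ _))
      (eVariationOn.edist_le A ⟨mem_univ _, hst, le_rfl⟩ ⟨mem_univ _, le_rfl, hst⟩)
  refine ⟨hmono, fun s t => ?_, fun τ => ⟨A.rightLim τ, ?_, ?_⟩, fun τ => ⟨A.leftLim τ, ?_, ?_⟩⟩
  · rcases le_total s t with h | h
    · rw [abs_of_nonneg (sub_nonneg.2 (hmono h))]; exact hle s t h
    · rw [abs_sub_comm, norm_sub_rev, abs_of_nonneg (sub_nonneg.2 (hmono h))]; exact hle t s h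
  · apply tendsto_rightLim_of_tendsto
    obtain ⟨l, hl⟩ := (hA τ (τ + 1) (mem_univ _) (mem_univ _)).exists_tendsto_right τ
    refine ⟨l, ?_⟩
    have e : univ ∩ Icc τ (τ + 1) ∩ Ioi τ = Ioc τ (τ + 1) := by
      ext x; simp only [mem_inter_iff, mem_univ, true_and, mem_Icc, mem_Ioi, mem_Ioc]
      exact ⟨fun h => ⟨h.2, h.1.2⟩, fun h => ⟨⟨h.1.le, h.2⟩, h.1⟩⟩
    rwa [e, nhdsWithin_Ioc_eq_nhdsGT (lt_add_one τ)] at hl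
  · exact (hH τ).2
  · apply tendsto_leftLim_of_tendsto
    obtain ⟨l, hl⟩ := (hA (τ - 1) τ (mem_univ _) (mem_univ _)).exists_tendsto_left τ
    refine ⟨l, ?_⟩
    have e : univ ∩ Icc (τ - 1) τ ∩ Iio τ = Ico (τ - 1) τ := by
      ext x; simp only [mem_inter_iff, mem_univ, true_and, mem_Icc, mem_Iio, mem_Ico]
      exact ⟨fun h => ⟨h.1.1, h.2⟩, fun h => ⟨⟨h.1, h.2.le⟩, h.2⟩⟩
    rwa [e, nhdsWithin_Ico_eq_nhdsLT (sub_one_lt τ)] at hl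
  · have := (hH τ).1
    rwa [jumpLeft, sub_eq_add_neg, neg_sub] at this

/-- Floquet's relation for a fundamental solution of a periodic equation. -/
theorem IsFundamentalSol.add_period (hV : Monotone V) {X : ℝ → (ROp n)ˣ}
    (hX : IsFundamentalSol A V X) (h0 : X 0 = 1)
    (hC : ∀ a b, ∃ C, ∀ s ∈ Icc a b, ∀ t ∈ Icc a b, ‖((X t * (X s)⁻¹ : (ROp n)ˣ) : ROp n)‖ ≤ C)
    {ω : ℝ} {C : ROp n} (hper : ∀ t, A (t + ω) - A t = C) (t : ℝ) :
    X (t + ω) = X t * X ω := by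
  refine Units.ext ?_
  ext1 v
  have hinc : ∀ s t, A (t + ω) - A (s + ω) = A t - A s := by
    intro s t
    have h1 := hper s; have h2 := hper t
    rw [sub_eq_iff_eq_add] at h1 h2
    rw [h1, h2]; abel
  -- The translate `X (t + ω) v` solves the same equation, with control function `V (t + ω)`, and
  -- has value `X ω v` at 0.
  have key := hX.eq_of_eventually hV (V' := fun t => V (t + ω))
    (fun a b hab => hV (by linarith)) hC
    (z := fun t => ((X (t + ω) * (X 0)⁻¹ : (ROp n)ˣ) : ROp n) v) (by
      intro ε hε τ
      have h1 := hX.eventually_apply 0 v hε (τ + ω)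
      have h2 : Tendsto (fun t => t + ω) (𝓝 τ) (𝓝 (τ + ω)) :=
        (continuous_add_const ω).tendsto τ
      filter_upwards [h2.eventually h1] with t ht
      rwa [hinc] at ht) 0 t
  simpa [h0] using key

theorem IsFundamentalSol.add_int_mul_period {X : ℝ → (ROp n)ˣ} {ω : ℝ}
    (h : ∀ t, X (t + ω) = X t * X ω) (k : ℤ) (t : ℝ) : X (t + k * ω) = X t * X ω ^ k := by
  induction k using Int.induction_on generalizing t with
  | zero => simp
  | succ k ih =>
    rw [zpow_add_one, ← mul_assoc, ← ih, ← h]; congr 1; push_cast; ring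
  | pred k ih =>
    rw [zpow_sub_one, ← mul_assoc, ← ih, eq_mul_inv_iff_mul_eq, ← h]; congr 1; push_cast; ring

end Floquet

/-! ### Decaying orbits on generalized eigenspaces. -/

section Decay

/-- An inhomogeneous contraction recursion with vanishing source converges to zero. -/
theorem tendsto_zero_of_recurrence {𝕜 E : Type*} [NormedField 𝕜] [NormedAddCommGroup E]
    [NormedSpace 𝕜 E] {c : 𝕜} (hc : ‖c‖ < 1) {x y : ℕ → E} (hy : Tendsto y atTop (𝓝 0))
    (h : ∀ k, x (k + 1) = c • x k + y k) : Tendsto x atTop (𝓝 0) := by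
  rw [Metric.tendsto_atTop] at hy
  refine Metric.tendsto_atTop.2 fun ε hε => ?_
  set ρ := ‖c‖ with hρ
  have hρ0 : 0 ≤ ρ := norm_nonneg c
  obtain ⟨N, hN⟩ := hy (ε / 2 * (1 - ρ)) (mul_pos (half_pos hε) (by linarith))
  have hb : ∀ j, ‖x (N + j)‖ ≤ ε / 2 + ρ ^ j * ‖x N‖ := by
    intro j
    induction j with
    | zero => simpa using (half_pos hε).le
    | succ j ih =>
      have h1 : ‖y (N + j)‖ < ε / 2 * (1 - ρ) := by simpa using hN (N + j) (Nat.le_add_right _ _)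
      calc ‖x (N + (j + 1))‖ = ‖c • x (N + j) + y (N + j)‖ := by rw [← add_assoc, h]
        _ ≤ ρ * ‖x (N + j)‖ + ‖y (N + j)‖ := (norm_add_le _ _).trans (by rw [norm_smul])
        _ ≤ ρ * (ε / 2 + ρ ^ j * ‖x N‖) + ε / 2 * (1 - ρ) := by gcongr
        _ = _ := by ring
  have hlim : Tendsto (fun j : ℕ => ρ ^ j * ‖x N‖) atTop (𝓝 0) := by
    simpa using (tendsto_pow_atTop_nhds_zero_of_lt_one hρ0 hc).mul_const ‖x N‖
  obtain ⟨J, hJ⟩ := eventually_atTop.1 (hlim.eventually_lt_const (half_pos hε))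
  refine ⟨N + J, fun k hk => ?_⟩
  obtain ⟨j, rfl⟩ := Nat.exists_eq_add_of_le ((Nat.le_add_right N J).trans hk)
  rw [dist_zero_right]
  linarith [hb j, hJ j (by omega)]

/-- The subspace of vectors whose orbit under `T` tends to zero. -/
def decaySubmodule {𝕜 E : Type*} [NormedField 𝕜] [NormedAddCommGroup E] [NormedSpace 𝕜 E]
    (T : Module.End 𝕜 E) : Submodule 𝕜 E where
  carrier := {v | Tendsto (fun k : ℕ => (T ^ k) v) atTop (𝓝 0)}
  add_mem' := fun {v w} hv hw => by
    simpa only [mem_ofPred_eq, map_add, add_zero] using hv.add hw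
  zero_mem' := by simp
  smul_mem' := fun c v hv => by
    simpa only [mem_ofPred_eq, map_smul, smul_zero] using hv.const_smul c

theorem mem_decaySubmodule {𝕜 E : Type*} [NormedField 𝕜] [NormedAddCommGroup E]
    [NormedSpace 𝕜 E] {T : Module.End 𝕜 E} {v : E} :
    v ∈ decaySubmodule T ↔ Tendsto (fun k : ℕ => (T ^ k) v) atTop (𝓝 0) := Iff.rfl

variable {𝕜 E : Type*} [NormedField 𝕜] [NormedAddCommGroup E] [NormedSpace 𝕜 E]
  {T S : Module.End 𝕜 E}

/-- With `w = (T - μ) v`, the orbit satisfies `T ^ (j + 1) v = μ • T ^ j v + T ^ j w`. The source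
decays by induction on the nilpotency order and `|μ| < 1` makes the recursion contracting. -/
theorem maxGenEigenspace_le_decaySubmodule {μ : 𝕜} (hμ : ‖μ‖ < 1) :
    T.maxGenEigenspace μ ≤ decaySubmodule T := by
  intro v hv
  obtain ⟨k, hk⟩ := (Module.End.mem_maxGenEigenspace T μ v).1 hv
  clear hv
  induction k generalizing v with
  | zero =>
    obtain rfl : v = 0 := by simpa using hk
    exact zero_mem _
  | succ k ih =>
    set w := (T - μ • (1 : Module.End 𝕜 E)) v with hw
    have hwd : w ∈ decaySubmodule T := ih (by
      rw [hw, ← Module.End.mul_apply, ← pow_succ]; exact hk)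
    have hTv : T v = μ • v + w := by rw [hw]; simp
    refine tendsto_zero_of_recurrence hμ hwd fun j => ?_
    rw [pow_succ, Module.End.mul_apply, hTv, map_add, map_smul]

/-- Applying `S ^ (j + 1)` to `T v = μ • v + w` and solving for `S ^ (j + 1) v` gives a recursion
with ratio `μ⁻¹`. -/
theorem maxGenEigenspace_le_decaySubmodule_inv (hST : S * T = 1) {μ : 𝕜} (hμ : 1 < ‖μ‖) :
    T.maxGenEigenspace μ ≤ decaySubmodule S := by
  have hμ0 : μ ≠ 0 := norm_pos_iff.1 (one_pos.trans hμ)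
  intro v hv
  obtain ⟨k, hk⟩ := (Module.End.mem_maxGenEigenspace T μ v).1 hv
  clear hv
  induction k generalizing v with
  | zero =>
    obtain rfl : v = 0 := by simpa using hk
    exact zero_mem _
  | succ k ih =>
    set w := (T - μ • (1 : Module.End 𝕜 E)) v with hw
    have hwd : w ∈ decaySubmodule S := ih (by
      rw [hw, ← Module.End.mul_apply, ← pow_succ]; exact hk)
    have hTv : T v = μ • v + w := by rw [hw]; simp
    have hsrc : Tendsto (fun j : ℕ => -(μ⁻¹ • (S ^ (j + 1)) w)) atTop (𝓝 0) := by
      have := (((tendsto_add_atTop_iff_nat 1).2 (mem_decaySubmodule.1 hwd)).const_smul μ⁻¹).neg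
      simpa using this
    refine tendsto_zero_of_recurrence (c := μ⁻¹) (by rw [norm_inv]; exact inv_lt_one_of_one_lt₀ hμ)
      hsrc fun j => ?_
    have e : (S ^ j) v = μ • (S ^ (j + 1)) v + (S ^ (j + 1)) w := by
      rw [← map_smul, ← map_add, ← hTv, pow_succ, Module.End.mul_apply, ← Module.End.mul_apply S T,
        hST, Module.End.one_apply]
    rw [e, smul_add, smul_smul, inv_mul_cancel₀ hμ0, one_smul]; abel

end Decay

/-! ### Real stable and unstable subspaces of the monodromy matrix. -/

section LinearAlgebra

variable {n : ℕ}

theorem coe_pow_apply_clm (L : ROp n) (k : ℕ) (v : RSpace n) :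
    ((L : RSpace n →ₗ[ℝ] RSpace n) ^ k) v = (L ^ k) v := by
  induction k generalizing v with
  | zero => simp
  | succ k ih => rw [pow_succ, pow_succ, Module.End.mul_apply, ih]; rfl

/-- The coordinatewise real part of a complex vector. -/
noncomputable def rePart (v : Fin n → ℂ) : RSpace n := WithLp.toLp 2 fun i => (v i).re

theorem continuous_rePart : Continuous (rePart : (Fin n → ℂ) → RSpace n) := by
  unfold rePart
  exact (PiLp.continuous_toLp 2 _).comp
    (continuous_pi fun i => Complex.continuous_re.comp (continuous_apply i))

/-- `M` is real, so real parts carry complex orbits to real ones. This brings the complex spectral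
decomposition back to `ℝⁿ`. -/
theorem rePart_toLin (M : ROp n) (v : Fin n → ℂ) :
    rePart (Matrix.toLin' (complexMatrix M) v) = M (rePart v) := by
  ext i
  have h := congrFun (LinearMap.toMatrix_mulVec_repr (EuclideanSpace.basisFun (Fin n) ℝ).toBasis
    (EuclideanSpace.basisFun (Fin n) ℝ).toBasis (M : RSpace n →ₗ[ℝ] RSpace n) (rePart v)) i
  simp only [OrthonormalBasis.coe_toBasis_repr_apply, EuclideanSpace.basisFun_repr,
    ContinuousLinearMap.coe_coe] at h
  rw [← h]
  simp [rePart, complexMatrix, Matrix.mulVec, dotProduct, Matrix.toLin'_apply]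

theorem rePart_toLin_pow (M : ROp n) (k : ℕ) (v : Fin n → ℂ) :
    rePart ((Matrix.toLin' (complexMatrix M) ^ k) v) = (M ^ k) (rePart v) := by
  induction k generalizing v with
  | zero => simp
  | succ k ih =>
    rw [pow_succ, pow_succ, Module.End.mul_apply, ih, rePart_toLin]; rfl

theorem toLin_complexMatrix_mul_eq_one {M N : ROp n} (h : M * N = 1) :
    Matrix.toLin' (complexMatrix M) * Matrix.toLin' (complexMatrix N) = 1 := by
  have h1 : complexMatrix M * complexMatrix N = 1 := by
    unfold complexMatrix
    rw [← Matrix.map_mul, ← LinearMap.toMatrix_comp]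
    have e : (M : RSpace n →ₗ[ℝ] RSpace n) ∘ₗ (N : RSpace n →ₗ[ℝ] RSpace n) = LinearMap.id := by
      ext1 v; exact congrArg (fun L : ROp n => L v) h
    rw [e, LinearMap.toMatrix_id]
    simp
  rw [Module.End.mul_eq_comp, ← Matrix.toLin'_mul, h1, Matrix.toLin'_one]; rfl

/-- An eigenvalue of modulus one yields a nonzero real vector with bounded two-sided orbit. -/
theorem exists_bounded_orbit (M : (ROp n)ˣ) {μ : ℂ} (hμ : IsComplexEigenvalue (M : ROp n) μ)
    (h1 : ‖μ‖ = 1) :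
    ∃ w : RSpace n, w ≠ 0 ∧ ∃ c, ∀ k : ℤ, ‖((M ^ k : (ROp n)ˣ) : ROp n) w‖ ≤ c := by
  have hμ0 : μ ≠ 0 := by rintro rfl; simp at h1
  obtain ⟨v, hv, hre⟩ : ∃ v : Fin n → ℂ, Matrix.toLin' (complexMatrix (M : ROp n)) v = μ • v ∧
      rePart v ≠ 0 := by
    obtain ⟨v, hv⟩ := Module.End.HasEigenvalue.exists_hasEigenvector hμ
    -- A purely imaginary eigenvector becomes real after multiplication by `-i`.
    by_cases hre : rePart v = 0
    · refine ⟨(-Complex.I) • v, by rw [map_smul, hv.apply_eq_smul, smul_comm], fun him => ?_⟩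
      refine hv.2 (funext fun i => Complex.ext ?_ ?_)
      · simpa [rePart] using congrArg (fun u : RSpace n => u i) hre
      · simpa [rePart] using congrArg (fun u : RSpace n => u i) him
    · exact ⟨v, hv.apply_eq_smul, hre⟩
  have hstep : ∀ k : ℤ, (M : ROp n) (rePart (μ ^ k • v)) = rePart (μ ^ (k + 1) • v) := by
    intro k
    rw [← rePart_toLin, map_smul, hv, smul_smul, zpow_add_one₀ hμ0]
  have horb : ∀ k : ℤ, ((M ^ k : (ROp n)ˣ) : ROp n) (rePart v) = rePart (μ ^ k • v) := by
    intro k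
    induction k using Int.induction_on with
    | zero => simp
    | succ k ih =>
      rw [add_comm (k : ℤ), zpow_one_add, Units.val_mul, mul_apply_eq_comp, ih, hstep,
        add_comm (k : ℤ)]
    | pred k ih =>
      have := hstep (-(k : ℤ) - 1)
      rw [sub_add_cancel, ← ih] at this
      rw [sub_eq_neg_add, zpow_add, zpow_neg_one, Units.val_mul, mul_apply_eq_comp, ← this,
        ← mul_apply_eq_comp, ← Units.val_mul, inv_mul_cancel, neg_add_eq_sub]
      rfl
  refine ⟨rePart v, hre, √(∑ i, ‖v i‖ ^ 2), fun k => ?_⟩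
  rw [horb, EuclideanSpace.norm_eq]
  refine Real.sqrt_le_sqrt (Finset.sum_le_sum fun i _ => ?_)
  have : ‖(rePart (μ ^ k • v)) i‖ ≤ ‖v i‖ := by
    have h2 := Complex.abs_re_le_norm ((μ ^ k • v) i)
    rw [Pi.smul_apply, norm_smul, norm_zpow, h1, one_zpow, one_mul] at h2
    exact h2
  gcongr

/-- Without eigenvalues of modulus one, the forward and backward decaying vectors span. -/
theorem decaySubmodule_sup_eq_top (M : (ROp n)ˣ)
    (hμ : ∀ μ : ℂ, IsComplexEigenvalue (M : ROp n) μ → ‖μ‖ ≠ 1) :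
    decaySubmodule ((M : ROp n) : RSpace n →ₗ[ℝ] RSpace n) ⊔
      decaySubmodule (((M⁻¹ : (ROp n)ˣ) : ROp n) : RSpace n →ₗ[ℝ] RSpace n) = ⊤ := by
  set T := Matrix.toLin' (complexMatrix (M : ROp n)) with hT
  set S := Matrix.toLin' (complexMatrix ((M⁻¹ : (ROp n)ˣ) : ROp n)) with hS
  have hST : S * T = 1 := toLin_complexMatrix_mul_eq_one (Units.inv_mul M)
  have hsup : decaySubmodule T ⊔ decaySubmodule S = ⊤ := by
    rw [eq_top_iff, ← Module.End.iSup_maxGenEigenspace_eq_top T]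
    refine iSup_le fun μ => ?_
    by_cases hbot : Module.End.maxGenEigenspace T μ = ⊥
    · rw [hbot]; exact bot_le
    · have hev : Module.End.HasEigenvalue T μ :=
        Module.End.HasUnifEigenvalue.lt (k := ⊤) zero_lt_one
          (show Module.End.HasUnifEigenvalue T μ ⊤ from hbot)
      rcases lt_or_gt_of_ne (hμ μ hev) with h | h
      · exact (maxGenEigenspace_le_decaySubmodule h).trans le_sup_left
      · exact (maxGenEigenspace_le_decaySubmodule_inv hST h).trans le_sup_right
  have hre : ∀ (L : ROp n) (v : Fin n → ℂ),
      v ∈ decaySubmodule (Matrix.toLin' (complexMatrix L)) →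
        rePart v ∈ decaySubmodule (L : RSpace n →ₗ[ℝ] RSpace n) := by
    intro L v hv
    have h0 : rePart (0 : Fin n → ℂ) = 0 := by ext i; simp [rePart]
    have := (continuous_rePart.tendsto 0).comp (mem_decaySubmodule.1 hv)
    rw [h0] at this
    refine this.congr fun k => ?_
    rw [Function.comp_apply, rePart_toLin_pow, coe_pow_apply_clm]
  refine eq_top_iff.2 fun w _ => ?_
  have hw : (fun i => (w i : ℂ)) ∈ decaySubmodule T ⊔ decaySubmodule S := hsup ▸ Submodule.mem_top
  obtain ⟨v₁, h₁, v₂, h₂, h⟩ := Submodule.mem_sup.1 hw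
  refine Submodule.mem_sup.2 ⟨rePart v₁, hre _ _ h₁, rePart v₂, hre _ _ h₂, ?_⟩
  ext i
  simpa [rePart] using congrArg Complex.re (congrFun h i)

theorem tendsto_zero_of_tendsto_apply {L : ℕ → ROp n}
    (h : ∀ v, Tendsto (fun k => L k v) atTop (𝓝 0)) : Tendsto L atTop (𝓝 0) := by
  have hb : ∀ k, ‖L k‖ ≤ ∑ i, ‖L k (EuclideanSpace.basisFun (Fin n) ℝ i)‖ := by
    intro k
    refine ContinuousLinearMap.opNorm_le_bound _ (Finset.sum_nonneg fun i _ => norm_nonneg _)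
      fun v => ?_
    conv_lhs => rw [← (EuclideanSpace.basisFun (Fin n) ℝ).sum_repr v]
    rw [map_sum, Finset.sum_mul]
    refine norm_sum_le_of_le _ fun i _ => ?_
    rw [map_smul, norm_smul, mul_comm]
    gcongr
    rw [EuclideanSpace.basisFun_repr]
    exact PiLp.norm_apply_le v i
  refine squeeze_zero_norm hb ?_
  simpa using tendsto_finsetSum (Finset.univ : Finset (Fin n)) fun i _ =>
    (h (EuclideanSpace.basisFun (Fin n) ℝ i)).norm

theorem apply_mem_decaySubmodule {L N : ROp n} (h : Commute L N) {v : RSpace n}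
    (hv : v ∈ decaySubmodule (L : RSpace n →ₗ[ℝ] RSpace n)) :
    N v ∈ decaySubmodule (L : RSpace n →ₗ[ℝ] RSpace n) := by
  have := (N.continuous.tendsto 0).comp (mem_decaySubmodule.1 hv)
  rw [map_zero] at this
  refine this.congr fun k => ?_
  rw [Function.comp_apply, coe_pow_apply_clm, coe_pow_apply_clm, ← mul_apply_eq_comp,
    ← mul_apply_eq_comp, (h.pow_left k).eq]

/-- In finite dimension, pointwise decay on a subspace is uniform. On the intersection some `M ^ k`
and `M⁻¹ ^ k` both halve norms, and the intersection is stable under `M⁻¹`; hence `w = M ^ k (M⁻¹ ^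
k w)` has norm at most `‖w‖ / 4`. -/
theorem decaySubmodule_disjoint (M : (ROp n)ˣ) :
    Disjoint (decaySubmodule ((M : ROp n) : RSpace n →ₗ[ℝ] RSpace n))
      (decaySubmodule (((M⁻¹ : (ROp n)ˣ) : ROp n) : RSpace n →ₗ[ℝ] RSpace n)) := by
  have hunif : ∀ (L : ROp n) (F : Submodule ℝ (RSpace n)),
      F ≤ decaySubmodule (L : RSpace n →ₗ[ℝ] RSpace n) →
        ∀ᶠ k : ℕ in atTop, ∀ w ∈ F, ‖(L ^ k) w‖ ≤ 1 / 2 * ‖w‖ := by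
    intro L F hF
    have h0 : Tendsto (fun k : ℕ => L ^ k * F.starProjection) atTop (𝓝 0) := by
      refine tendsto_zero_of_tendsto_apply fun v => ?_
      refine (mem_decaySubmodule.1 (hF (F.starProjection_apply_mem v))).congr fun k => ?_
      rw [coe_pow_apply_clm]; rfl
    filter_upwards [h0.norm.eventually_lt_const (by simp : ‖(0 : ROp n)‖ < 1 / 2)] with k hk w hw
    have e : (L ^ k) w = (L ^ k * F.starProjection) w := by
      rw [mul_apply_eq_comp, Submodule.starProjection_eq_self_iff.2 hw]
    rw [e]
    exact ContinuousLinearMap.le_of_opNorm_le _ hk.le w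
  rw [Submodule.disjoint_def]
  intro w hw₁ hw₂
  set F := decaySubmodule ((M : ROp n) : RSpace n →ₗ[ℝ] RSpace n) ⊓
    decaySubmodule (((M⁻¹ : (ROp n)ˣ) : ROp n) : RSpace n →ₗ[ℝ] RSpace n) with hF
  obtain ⟨k, h₁, h₂⟩ := ((hunif _ _ (inf_le_left : F ≤ _)).and
    (hunif _ _ (inf_le_right : F ≤ _))).exists
  have hcomm : Commute ((M : ROp n)) ((M⁻¹ : (ROp n)ˣ) : ROp n) :=
    (M.mul_inv).trans (M.inv_mul).symm
  have hmem : (((M⁻¹ : (ROp n)ˣ) : ROp n) ^ k) w ∈ F :=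
    ⟨apply_mem_decaySubmodule (hcomm.pow_right k) hw₁,
      apply_mem_decaySubmodule ((Commute.refl _).pow_right k) hw₂⟩
  have e : ((M : ROp n) ^ k) ((((M⁻¹ : (ROp n)ˣ) : ROp n) ^ k) w) = w := by
    rw [← mul_apply_eq_comp, ← hcomm.mul_pow, Units.mul_inv, one_pow]; rfl
  have b₁ := h₁ _ hmem
  have b₂ := h₂ w ⟨hw₁, hw₂⟩
  rw [e] at b₁
  exact norm_le_zero_iff.1 (by linarith [norm_nonneg w])

end LinearAlgebra

/-! ### Exponential dichotomy and the spectrum of the monodromy matrix. -/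

section Dichotomy

variable {n : ℕ}

/-- Powers of an operator that decay on a commuting projection decay exponentially. -/
theorem exists_exponential_bound {L Q : ROp n} (hLQ : Commute L Q) (hQ : Q * Q = Q)
    (h : Tendsto (fun k : ℕ => L ^ k * Q) atTop (𝓝 0)) :
    ∃ K > 0, ∃ β > 0, ∀ k : ℕ, ‖L ^ k * Q‖ ≤ K * Real.exp (-β * k) := by
  obtain ⟨N, hN, hN1⟩ := ((h.norm.eventually_lt_const (by simp : ‖(0 : ROp n)‖ < 1 / 2)).and
    (eventually_ge_atTop 1)).exists
  have hN0 : (0 : ℝ) < N := Nat.cast_pos.2 hN1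
  -- Since `Q` is idempotent and commutes with `L`, the norms are submultiplicative in the exponent,
  -- and one value below `1 / 2` already forces exponential decay.
  have hmul : ∀ j k : ℕ, ‖L ^ (j + k) * Q‖ ≤ ‖L ^ j * Q‖ * ‖L ^ k * Q‖ := by
    intro j k
    have e : L ^ (j + k) * Q = (L ^ j * Q) * (L ^ k * Q) := by
      rw [mul_assoc, ← mul_assoc Q, ← (hLQ.pow_left k).eq, mul_assoc (L ^ k), hQ, ← mul_assoc,
        pow_add]
    rw [e]; exact norm_mul_le _ _
  set B := ∑ r ∈ Finset.range N, ‖L ^ r * Q‖ + 1 with hB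
  have hB0 : 0 < B := by positivity
  have hr : ∀ r < N, ‖L ^ r * Q‖ ≤ B := fun r hr => by
    have := Finset.single_le_sum (f := fun r => ‖L ^ r * Q‖) (fun i _ => norm_nonneg _)
      (Finset.mem_range.2 hr)
    linarith
  have hq : ∀ q r : ℕ, r < N → ‖L ^ (N * q + r) * Q‖ ≤ (1 / 2) ^ q * B := by
    intro q r hrN
    induction q with
    | zero => simpa using hr r hrN
    | succ q ih =>
      have e : N * (q + 1) + r = N + (N * q + r) := by ring
      rw [e, pow_succ', mul_assoc]
      exact (hmul _ _).trans (mul_le_mul hN.le ih (norm_nonneg _) (by norm_num))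
  -- Each block of `N` steps halves the norm, hence the rate `log 2 / N`; the factor 2 pays for
  -- rounding `k / N` down.
  refine ⟨2 * B, by positivity, Real.log 2 / N, div_pos (Real.log_pos one_lt_two) hN0, fun k => ?_⟩
  have hdecomp : N * (k / N) + k % N = k := Nat.div_add_mod k N
  have hmod : k % N < N := Nat.mod_lt k hN1
  have h1 := hq (k / N) (k % N) hmod
  rw [hdecomp] at h1
  refine h1.trans ?_
  have h2 : ((1 : ℝ) / 2) ^ (k / N) = Real.exp (-Real.log 2 * ((k / N : ℕ) : ℝ)) := by
    rw [mul_comm, Real.exp_nat_mul, Real.exp_neg, Real.exp_log two_pos, one_div]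
  have h3 : (2 : ℝ) = Real.exp (Real.log 2) := (Real.exp_log two_pos).symm
  have h4 : (k : ℝ) ≤ N * ((k / N : ℕ) + 1) := by
    have : k ≤ N * (k / N + 1) := by
      calc k = N * (k / N) + k % N := hdecomp.symm
        _ ≤ N * (k / N) + N := by omega
        _ = _ := by ring
    exact_mod_cast this
  have h5 : ((1 : ℝ) / 2) ^ (k / N) ≤ 2 * Real.exp (-(Real.log 2 / N) * k) := by
    rw [h2]
    nth_rewrite 2 [h3]
    rw [← Real.exp_add, Real.exp_le_exp]
    have hl := Real.log_pos one_lt_two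
    have : Real.log 2 / N * k ≤ Real.log 2 * ((k / N : ℕ) + 1) := by
      rw [div_mul_eq_mul_div, div_le_iff₀ hN0]
      nlinarith
    linarith
  calc _ ≤ (2 * Real.exp (-(Real.log 2 / N) * k)) * B := by gcongr
    _ = _ := by ring

/-- The hyperbolic splitting of an invertible matrix without eigenvalues of modulus one. -/
theorem exists_hyperbolic_projection (M : (ROp n)ˣ)
    (hμ : ∀ μ : ℂ, IsComplexEigenvalue (M : ROp n) μ → ‖μ‖ ≠ 1) :
    ∃ P : ROp n, P * P = P ∧ Commute (M : ROp n) P ∧ ∃ K > 0, ∃ β > 0, ∀ k : ℕ,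
      ‖((M ^ (k : ℤ) : (ROp n)ˣ) : ROp n) * P‖ ≤ K * Real.exp (-β * k) ∧
      ‖((M ^ (-(k : ℤ)) : (ROp n)ˣ) : ROp n) * (1 - P)‖ ≤ K * Real.exp (-β * k) := by
  set Es := decaySubmodule ((M : ROp n) : RSpace n →ₗ[ℝ] RSpace n) with hEs
  set Eu := decaySubmodule (((M⁻¹ : (ROp n)ˣ) : ROp n) : RSpace n →ₗ[ℝ] RSpace n) with hEu
  have hc : IsCompl Es Eu :=
    ⟨decaySubmodule_disjoint M, codisjoint_iff.2 (decaySubmodule_sup_eq_top M hμ)⟩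
  have hinv : Commute (M : ROp n) ((M⁻¹ : (ROp n)ˣ) : ROp n) := (M.mul_inv).trans (M.inv_mul).symm
  set P : ROp n := LinearMap.toContinuousLinearMap (Es.projection Eu hc) with hP
  have hPs : ∀ v, P v ∈ Es := fun v => Submodule.projection_apply_mem hc v
  have hPu : ∀ v, (1 - P) v ∈ Eu := fun v => Submodule.sub_projection_mem hc v
  have hfix : ∀ v ∈ Es, P v = v := fun v hv => Submodule.projection_apply_of_mem_left hc hv
  have hker : ∀ v ∈ Eu, P v = 0 := fun v hv => (Submodule.projection_apply_eq_zero_iff hc).2 hv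
  have hPP : P * P = P := by
    ext1 v
    rw [mul_apply_eq_comp, hfix _ (hPs v)]
  have hMP : Commute (M : ROp n) P := by
    ext1 v
    have hv : v = P v + (1 - P) v := by simp
    have h1 : (M : ROp n) (P v) ∈ Es := apply_mem_decaySubmodule (Commute.refl _) (hPs v)
    have h2 : (M : ROp n) ((1 - P) v) ∈ Eu := apply_mem_decaySubmodule hinv.symm (hPu v)
    rw [mul_apply_eq_comp, mul_apply_eq_comp]
    conv_rhs => rw [hv, map_add, map_add, hfix _ h1, hker _ h2, add_zero]
  have hQQ : (1 - P) * (1 - P) = 1 - P := by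
    simp only [mul_sub, sub_mul, hPP, mul_one, one_mul, sub_self, sub_zero]
  have hMQ : Commute ((M⁻¹ : (ROp n)ˣ) : ROp n) (1 - P) :=
    (Commute.one_right _).sub_right (Commute.units_inv_left hMP)
  obtain ⟨K₁, hK₁, β₁, hβ₁, b₁⟩ := exists_exponential_bound hMP hPP
    (tendsto_zero_of_tendsto_apply fun v => by
      refine (mem_decaySubmodule.1 (hPs v)).congr fun k => ?_
      rw [coe_pow_apply_clm]; rfl)
  obtain ⟨K₂, hK₂, β₂, hβ₂, b₂⟩ := exists_exponential_bound hMQ hQQ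
    (tendsto_zero_of_tendsto_apply fun v => by
      refine (mem_decaySubmodule.1 (hPu v)).congr fun k => ?_
      rw [coe_pow_apply_clm]; rfl)
  refine ⟨P, hPP, hMP, max K₁ K₂, lt_max_of_lt_left hK₁, min β₁ β₂, lt_min hβ₁ hβ₂, fun k => ?_⟩
  have hk : (0 : ℝ) ≤ k := Nat.cast_nonneg k
  have e₁ : Real.exp (-β₁ * k) ≤ Real.exp (-min β₁ β₂ * k) :=
    Real.exp_le_exp.2 (by nlinarith [min_le_left β₁ β₂])
  have e₂ : Real.exp (-β₂ * k) ≤ Real.exp (-min β₁ β₂ * k) :=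
    Real.exp_le_exp.2 (by nlinarith [min_le_right β₁ β₂])
  constructor
  · rw [zpow_natCast, Units.val_pow_eq_pow_val]
    exact (b₁ k).trans (mul_le_mul (le_max_left _ _) e₁ (Real.exp_nonneg _)
      (hK₁.le.trans (le_max_left _ _)))
  · rw [zpow_neg, zpow_natCast, ← inv_pow, Units.val_pow_eq_pow_val]
    exact (b₂ k).trans (mul_le_mul (le_max_right _ _) e₂ (Real.exp_nonneg _)
      (hK₁.le.trans (le_max_left _ _)))

/-- Transfer of exponential decay from the monodromy operator to the fundamental solution. -/
theorem norm_fundamental_conj_le {X : ℝ → (ROp n)ˣ} {ω C K β : ℝ} (hω : 0 < ω) (hK : 0 ≤ K)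
    (hβ : 0 < β) (hX : ∀ t (k : ℤ), X (t + k * ω) = X t * X ω ^ k)
    (hC : ∀ t ∈ Icc 0 ω, ‖(X t : ROp n)‖ ≤ C ∧ ‖(((X t)⁻¹ : (ROp n)ˣ) : ROp n)‖ ≤ C)
    {Q : ROp n} (hQ : Commute (X ω : ROp n) Q) {t s : ℝ}
    (hb : ∀ k : ℤ, (s ≤ t → 0 ≤ k) → (t ≤ s → k ≤ 0) →
      ‖((X ω ^ k : (ROp n)ˣ) : ROp n) * Q‖ ≤ K * Real.exp (-β * |(k : ℝ)|)) :
    ‖(X t : ROp n) * Q * (((X s)⁻¹ : (ROp n)ˣ) : ROp n)‖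
      ≤ C * C * K * Real.exp β * Real.exp (-(β / ω) * |t - s|) := by
  have hmem : ∀ r : ℝ, r - ⌊r / ω⌋ * ω ∈ Ico 0 ω := by
    intro r
    have h1 := Int.floor_le (r / ω)
    have h2 := Int.lt_floor_add_one (r / ω)
    rw [le_div_iff₀ hω] at h1
    rw [div_lt_iff₀ hω] at h2
    constructor <;> nlinarith
  have hrep : ∀ r : ℝ, X r = X (r - ⌊r / ω⌋ * ω) * X ω ^ ⌊r / ω⌋ := by
    intro r; rw [← hX, sub_add_cancel]
  set t' := t - ⌊t / ω⌋ * ω with ht'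
  set s' := s - ⌊s / ω⌋ * ω with hs'
  set k : ℤ := ⌊t / ω⌋ - ⌊s / ω⌋ with hk
  have htm := hmem t
  have hsm := hmem s
  have hdiff : t - s = (t' - s') + k * ω := by rw [ht', hs', hk]; push_cast; ring
  -- The integer parts account for `|t - s|` up to less than one period, which costs the factor `exp
  -- β` below.
  have hlt : |t - s| < (|(k : ℝ)| + 1) * ω := by
    rw [hdiff]
    calc _ ≤ |t' - s'| + |k * ω| := abs_add_le _ _
      _ < ω + |(k : ℝ)| * ω := by
        rw [abs_mul, abs_of_pos hω]
        have : |t' - s'| < ω := abs_lt.2 ⟨by linarith [htm.1, hsm.2], by linarith [htm.2, hsm.1]⟩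
        linarith
      _ = _ := by ring
  have hbk := hb k (fun h => sub_nonneg.2 (Int.floor_le_floor (by gcongr)))
    (fun h => sub_nonpos.2 (Int.floor_le_floor (by gcongr)))
  have e : (X t : ROp n) * Q * (((X s)⁻¹ : (ROp n)ˣ) : ROp n)
      = (X t' : ROp n) * (((X ω ^ k : (ROp n)ˣ) : ROp n) * Q) * (((X s')⁻¹ : (ROp n)ˣ) : ROp n) := by
    have hcomm : Commute (((X ω ^ (-⌊s / ω⌋)) : (ROp n)ˣ) : ROp n) Q := hQ.units_zpow_left _
    rw [hrep t, hrep s, mul_inv_rev, ← zpow_neg,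
      show k = ⌊t / ω⌋ + -⌊s / ω⌋ from sub_eq_add_neg _ _, zpow_add]
    simp only [Units.val_mul, mul_assoc]
    rw [← mul_assoc Q, ← hcomm.eq, mul_assoc]
  have hC' := hC t' (Ico_subset_Icc_self htm)
  have hC'' := hC s' (Ico_subset_Icc_self hsm)
  have hC0 : 0 ≤ C := (norm_nonneg _).trans hC'.1
  have hexp : Real.exp (-β * |(k : ℝ)|) ≤ Real.exp β * Real.exp (-(β / ω) * |t - s|) := by
    rw [← Real.exp_add, Real.exp_le_exp]
    have : β / ω * |t - s| ≤ β * (|(k : ℝ)| + 1) := by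
      rw [div_mul_eq_mul_div, div_le_iff₀ hω, mul_assoc]
      exact mul_le_mul_of_nonneg_left hlt.le hβ.le
    linarith
  rw [e]
  calc _ ≤ C * (K * Real.exp (-β * |(k : ℝ)|)) * C := by
        refine (norm_mul_le _ _).trans (mul_le_mul ((norm_mul_le _ _).trans
          (mul_le_mul hC'.1 hbk (norm_nonneg _) hC0)) hC''.2 (norm_nonneg _) (by positivity))
    _ ≤ C * (K * (Real.exp β * Real.exp (-(β / ω) * |t - s|))) * C := by gcongr
    _ = _ := by ring

theorem hasExponentialDichotomy_of_hyperbolic {X : ℝ → (ROp n)ˣ} {ω C : ℝ} (hω : 0 < ω)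
    (hX : ∀ t (k : ℤ), X (t + k * ω) = X t * X ω ^ k)
    (hC : ∀ t ∈ Icc 0 ω, ‖(X t : ROp n)‖ ≤ C ∧ ‖(((X t)⁻¹ : (ROp n)ˣ) : ROp n)‖ ≤ C)
    {U : ℝ → ℝ → ROp n} (hU : ∀ t, U t 0 = X t)
    (hμ : ∀ μ : ℂ, IsComplexEigenvalue (U ω 0) μ → ‖μ‖ ≠ 1) : HasExponentialDichotomy U := by
  rw [hU] at hμ
  obtain ⟨P, hPP, hMP, K, hK, β, hβ, hb⟩ := exists_hyperbolic_projection (X ω) hμ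
  set K' := C * C * K * Real.exp β with hK'
  have hK'0 : 0 ≤ K' := by
    have hC0 : 0 ≤ C := (norm_nonneg _).trans (hC 0 ⟨le_rfl, hω.le⟩).1
    positivity
  -- `K'` vanishes when `C = 0`, possible for `n = 0`, so 1 is added to keep the constant positive.
  refine ⟨K' + 1, β / ω, P, by linarith, div_pos hβ hω, hPP, fun t s hst => ?_, fun t s hst => ?_⟩
  · rw [hU, hU, Ring.inverse_unit]
    refine (norm_fundamental_conj_le hω hK.le hβ hX hC hMP fun k hk _ => ?_).trans ?_
    · obtain ⟨m, rfl⟩ := Int.eq_ofNat_of_zero_le (hk hst)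
      simpa using (hb m).1
    · rw [abs_of_nonneg (sub_nonneg.2 hst)]
      gcongr
      linarith
  · rw [hU, hU, Ring.inverse_unit]
    refine (norm_fundamental_conj_le hω hK.le hβ hX hC ((Commute.one_right _).sub_right hMP)
      fun k _ hk => ?_).trans ?_
    · obtain ⟨m, hm⟩ := Int.eq_ofNat_of_zero_le (neg_nonneg.2 (hk hst))
      obtain rfl : k = -(m : ℤ) := by omega
      simpa using (hb m).2
    · rw [abs_sub_comm, abs_of_nonneg (sub_nonneg.2 hst)]
      gcongr
      linarith

theorem HasExponentialDichotomy.norm_ne_one {X : ℝ → (ROp n)ˣ} {ω : ℝ} (hω : 0 < ω)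
    (h0 : X 0 = 1) (hX : ∀ t (k : ℤ), X (t + k * ω) = X t * X ω ^ k)
    {U : ℝ → ℝ → ROp n} (hU : ∀ t, U t 0 = X t) (h : HasExponentialDichotomy U)
    {μ : ℂ} (hμ : IsComplexEigenvalue (U ω 0) μ) : ‖μ‖ ≠ 1 := by
  intro h1
  rw [hU] at hμ
  obtain ⟨w, hw, c, hc⟩ := exists_bounded_orbit (X ω) hμ h1
  have hc0 : 0 ≤ c := (norm_nonneg _).trans (hc 0)
  have horb : ∀ k : ℤ, ‖(X (k * ω) : ROp n) w‖ ≤ c := fun k => by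
    have := hX 0 k
    rw [zero_add, h0, one_mul] at this
    rw [this]; exact hc k
  obtain ⟨K, α, P, hK, hα, -, hs, hu⟩ := h
  -- `Q w` equals `Q * (X s)⁻¹` applied to `X s w` with `s = r k * ω`: an operator decaying in `k`
  -- applied to a bounded orbit. The choices `r k = -k` and `r k = k` serve `P` and `1 - P`.
  have vanish : ∀ (Q : ROp n) (r : ℕ → ℤ),
      (∀ k, ‖U 0 0 * Q * Ring.inverse (U (r k * ω) 0)‖ ≤ K * Real.exp (-α * (k * ω))) →
        Q w = 0 := by
    intro Q r hQ
    have hb : ∀ k : ℕ, ‖Q w‖ ≤ K * Real.exp (-α * (k * ω)) * c := by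
      intro k
      have h2 := hQ k
      rw [hU, hU, h0, Units.val_one, one_mul, Ring.inverse_unit] at h2
      have e : Q w = (Q * (((X (r k * ω))⁻¹ : (ROp n)ˣ) : ROp n)) ((X (r k * ω) : ROp n) w) := by
        rw [← mul_apply_eq_comp, mul_assoc, Units.inv_mul, mul_one]
      rw [e]
      exact (ContinuousLinearMap.le_of_opNorm_le _ h2 _).trans (by gcongr; exact horb _)
    have hlim : Tendsto (fun k : ℕ => K * Real.exp (-α * (k * ω)) * c) atTop (𝓝 0) := by
      have h3 : Tendsto (fun k : ℕ => -α * ((k : ℝ) * ω)) atTop atBot :=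
        (tendsto_natCast_atTop_atTop.atTop_mul_const hω).const_mul_atTop_of_neg (by linarith)
      simpa using ((Real.tendsto_exp_atBot.comp h3).const_mul K).mul_const c
    exact norm_le_zero_iff.1 (ge_of_tendsto' hlim hb)
  have hP : P w = 0 := vanish P (fun k => -(k : ℤ)) fun k => by
    have hk : (0 : ℝ) ≤ k * ω := by positivity
    have := hs 0 (((-(k : ℤ) : ℤ) : ℝ) * ω) (by push_cast; linarith)
    refine this.trans_eq ?_
    push_cast; ring_nf
  have hQ : (1 - P) w = 0 := vanish (1 - P) (fun k => (k : ℤ)) fun k => by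
    have hk : (0 : ℝ) ≤ k * ω := by positivity
    have := hu 0 (((k : ℤ) : ℝ) * ω) (by push_cast; linarith)
    refine this.trans_eq ?_
    push_cast; ring_nf
  refine hw ?_
  have : w = P w + (1 - P) w := by simp
  rw [this, hP, hQ, add_zero]

end Dichotomy

theorem theorem3p3 {n : ℕ} (A : ℝ → ROp n)
    (hA : LocallyBoundedVariationOn A Set.univ) (hH : ConditionH A)
    (ω : ℝ) (hω : 0 < ω) (C : ROp n) (hper : ∀ t : ℝ, A (t + ω) - A t = C) :
    (∃! U : ℝ → ℝ → ROp n, IsTransitionMatrix A U) ∧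
    ∀ U : ℝ → ℝ → ROp n, IsTransitionMatrix A U →
      (HasExponentialDichotomy U ↔ ∀ μ : ℂ, IsComplexEigenvalue (U ω 0) μ → ‖μ‖ ≠ 1) := by
  have hreg := hA.isRegularIntegrator hH
  obtain ⟨X, h0, hX, hC⟩ := hreg.exists_isFundamentalSol ContinuousLinearMap.norm_id_le
  have huniq := fun (U : ℝ → ℝ → ROp n) (hU : IsTransitionMatrix A U) =>
    hU.eq hreg.mono hreg.bound hX hC
  refine ⟨⟨_, hX.isTransitionMatrix hreg.mono, huniq⟩, fun U hU => ?_⟩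
  have hU0 : ∀ t, U t 0 = X t := fun t => by rw [huniq U hU]; simp [h0]
  have hper' := IsFundamentalSol.add_int_mul_period (hX.add_period hreg.mono h0 hC hper)
  have hXk : ∀ t (k : ℤ), X (t + k * ω) = X t * X ω ^ k := fun t k => hper' k t
  refine ⟨fun h μ hμ => h.norm_ne_one hω h0 hXk hU0 hμ, fun hμ => ?_⟩
  -- As `X 0 = 1`, the transition bound between 0 and `t` bounds both `X t` and its inverse over one
  -- period.
  obtain ⟨B, hB⟩ := hC 0 ω
  have h0I : (0 : ℝ) ∈ Icc 0 ω := ⟨le_rfl, hω.le⟩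
  refine hasExponentialDichotomy_of_hyperbolic (C := B) hω hXk (fun t ht => ⟨?_, ?_⟩) hU0 hμ
  · simpa [h0] using hB 0 h0I t ht
  · simpa [h0] using hB t ht 0 h0I
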